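/- For Polish spaces $\mathsf X,\mathsf Y$, write $\mathcal P(\mathsf Y)$ for the set of Borel probability measures on $\mathsf Y$ with the weak topology, and $\Pi(\mu,\nu)$ for the set of couplings of $\mu\in\mathcal P(\mathsf X)$ and $\nu\in\mathcal P(\mathsf Y)$. For $\pi\in\Pi(\mu,\nu)$ let $(\pi_x)_{x}$ be a (any) disintegration of $\pi$ with respect to $\mu$ into a Borel kernel of probability measures. Integrals of functions with values in $[-\infty,+\infty]$ are the integral of the positive part minus that of the negative part, with the convention $\infty-\infty=+\infty$. (a) Let $\mathsf X,\mathsf Y$ be Polish, $\mu\in\mathcal P(\mathsf X)$, $\nu\in\mathcal P(\mathsf Y)$, and let $C:\mathsf X\times\mathcal P(\mathsf Y)\to\mathbb R\cup\{+\infty\}$ be Borel measurable (jointly), such that for $\mu$-a.e. $x$ the function $C(x,\cdot)$ is convex and lower semicontinuous on $\mathcal P(\mathsf Y)$. Suppose that the value $$\inf_{\pi\in\Pi(\mu,\nu)}\int_{\mathsf X} C(x,\pi_x)\,\mu(dx)$$ is finite and attained by $\pi\in\Pi(\mu,\nu)$. Then there is a Borel set $\Gamma\subset\mathsf X$ with $\mu(\Gamma)=1$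 such that for all $x,x'\in\Gamma$ and all $m_x,m_{x'}\in\mathcal P(\mathsf Y)$ with $m_x+m_{x'}=\pi_x+\pi_{x'}$, $$C(x,\pi_x)+C(x',\pi_{x'})\le C(x,m_x)+C(x',m_{x'}).$$ (b) Let $d\ge 0$, let $\mu,\nu\in\mathcal P(\mathbb R^d)$ have finite second moments, and let $\gamma^d$ be the standard Gaussian measure on $\mathbb R^d$. A martingale coupling is a $\pi\in\Pi(\mu,\nu)$ such that for $\mu$-a.e. $x$ the measure $\pi_x$ has a finite first moment and $\mathrm{mean}(\pi_x):=\int y\,\pi_x(dy)=x$. Let $\pi$ be a martingale coupling that attains the supremum $$\sup_{\pi}\int\mu(dx)\sup_{q\in\Pi(\pi_x,\gamma^d)}\int y\cdot b\;q(dy,db)$$ over all martingale couplings of $\mu$ and $\nu$ (so, in particular, $\mu$ and $\nu$ are in convex order). Then there is a Borel set $\Gamma\subset\mathbb R^d$ with $\mu(\Gamma)=1$ such that for all $x,x'\in\Gamma$ the measure $\tfrac12(\delta_x\pi_x+\delta_{x'}\pi_{x'})$ is optimal for $$\inf\Big\{\mathcal W_2(m_x,\gamma^d)^2+\mathcal W_2(m_{x'},\gamma^d)^2:\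 m_x,m_{x'}\in\mathcal P(\mathbb R^d),\ \mathrm{mean}(m_x)=x,\ \mathrm{mean}(m_{x'})=x',\ \tfrac{m_x+m_{x'}}2=\tfrac{\pi_x+\pi_{x'}}2\Big\},$$ that is, the pair $(\pi_x,\pi_{x'})$ satisfies these constraints and attains the infimum. Here $\mathcal W_2$ is the quadratic Wasserstein distance, and $\mathrm{mean}(m)=x$ includes that $m$ has a finite first moment. -/

import Mathlib

open MeasureTheory ProbabilityTheory
open scoped ENNReal NNReal

namespace WeakTransport

noncomputable section

/-- The integral of an extended real valued function: the integral of the positive part minus the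
integral of the negative part. It is `⊤` as soon as the positive part has infinite integral
(so `∞ - ∞` is read as `∞`). -/
def extIntegral {α : Type*} [MeasurableSpace α] (μ : Measure α) (f : α → EReal) : EReal :=
  open Classical in
  if ∫⁻ x, (f x).toENNReal ∂μ = ⊤ then ⊤
  else ((∫⁻ x, (f x).toENNReal ∂μ : ℝ≥0∞) : EReal) - ((∫⁻ x, (-f x).toENNReal ∂μ : ℝ≥0∞) : EReal)

/-- The set `Π(μ, ν)` of couplings of `μ` and `ν`. -/
def couplings {X Y : Type*} [MeasurableSpace X] [MeasurableSpace Y]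
    (μ : ProbabilityMeasure X) (ν : ProbabilityMeasure Y) : Set (ProbabilityMeasure (X × Y)) :=
  {π | (π : Measure (X × Y)).fst = μ ∧ (π : Measure (X × Y)).snd = ν}

/-- The values of a Markov kernel, as bundled probability measures. -/
def kernelLaw {X Y : Type*} [MeasurableSpace X] [MeasurableSpace Y]
    (κ : Kernel X Y) [IsMarkovKernel κ] (x : X) : ProbabilityMeasure Y :=
  ⟨κ x, inferInstance⟩

/-- The conditional law `π_x` of the second coordinate given that the first one is `x`. -/
def condLaw {X Y : Type*} [MeasurableSpace X] [MeasurableSpace Y] [StandardBorelSpace Y]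
    [Nonempty Y] (π : ProbabilityMeasure (X × Y)) (x : X) : ProbabilityMeasure Y :=
  kernelLaw (π : Measure (X × Y)).condKernel x

section General

variable {X Y : Type*} [MeasurableSpace X] [MeasurableSpace Y] [StandardBorelSpace Y] [Nonempty Y]

/-- The weak transport cost `∫ C(x, π_x) μ(dx)`. -/
def weakCost (C : X → ProbabilityMeasure Y → EReal) (μ : ProbabilityMeasure X)
    (π : ProbabilityMeasure (X × Y)) : EReal :=
  extIntegral (μ : Measure X) (fun x => C x (condLaw π x))

/-- The value `inf_{π ∈ Π(μ,ν)} ∫ C(x, π_x) μ(dx)` of the weak transport problem. -/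
def weakValue (C : X → ProbabilityMeasure Y → EReal) (μ : ProbabilityMeasure X)
    (ν : ProbabilityMeasure Y) : EReal :=
  ⨅ π ∈ couplings μ ν, weakCost C μ π

/-- `π` is an optimizer of the weak transport problem. -/
def IsWeakOptimizer (C : X → ProbabilityMeasure Y → EReal) (μ : ProbabilityMeasure X)
    (ν : ProbabilityMeasure Y) (π : ProbabilityMeasure (X × Y)) : Prop :=
  π ∈ couplings μ ν ∧ weakCost C μ π = weakValue C μ ν

end General

/-- Convexity of a function on the set of probability measures. -/
def ConvexOnLaws {Y : Type*} [MeasurableSpace Y] (F : ProbabilityMeasure Y → EReal) : Prop :=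
  ∀ (m₁ m₂ m : ProbabilityMeasure Y) (a b : ℝ≥0), a + b = 1 →
    (m : Measure Y) = a • (m₁ : Measure Y) + b • (m₂ : Measure Y) →
    F m ≤ ((a : ℝ) : EReal) * F m₁ + ((b : ℝ) : EReal) * F m₂

section Euclidean

variable {d : ℕ}

/-- The standard Gaussian measure `γ^d` on `ℝ^d`. -/
def gaussianLaw (d : ℕ) : ProbabilityMeasure (EuclideanSpace ℝ (Fin d)) :=
  ⟨stdGaussian (EuclideanSpace ℝ (Fin d)), inferInstance⟩

/-- `m` has a finite first moment and `mean(m) = x`. -/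
def HasMean (m : ProbabilityMeasure (EuclideanSpace ℝ (Fin d)))
    (x : EuclideanSpace ℝ (Fin d)) : Prop :=
  Integrable id (m : Measure (EuclideanSpace ℝ (Fin d))) ∧
    ∫ y, y ∂(m : Measure (EuclideanSpace ℝ (Fin d))) = x

/-- Couplings of `μ` and `ν` whose conditional laws satisfy `mean(π_x) = x`. -/
def martingaleCouplings (μ ν : ProbabilityMeasure (EuclideanSpace ℝ (Fin d))) :
    Set (ProbabilityMeasure (EuclideanSpace ℝ (Fin d) × EuclideanSpace ℝ (Fin d))) :=
  {π | π ∈ couplings μ ν ∧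
    ∀ᵐ x ∂(μ : Measure (EuclideanSpace ℝ (Fin d))), HasMean (condLaw π x) x}

/-- The maximal covariance `sup_{q ∈ Π(m,n)} ∫ y · b q(dy, db)`. -/
def maxCov (m n : ProbabilityMeasure (EuclideanSpace ℝ (Fin d))) : EReal :=
  ⨆ q ∈ couplings m n,
    extIntegral (q : Measure (EuclideanSpace ℝ (Fin d) × EuclideanSpace ℝ (Fin d)))
      (fun p => ((inner ℝ p.1 p.2 : ℝ) : EReal))

/-- The objective `∫ μ(dx) sup_{q ∈ Π(π_x, γ^d)} ∫ y · b q(dy, db)`. -/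
def martCost (μ : ProbabilityMeasure (EuclideanSpace ℝ (Fin d)))
    (π : ProbabilityMeasure (EuclideanSpace ℝ (Fin d) × EuclideanSpace ℝ (Fin d))) : EReal :=
  extIntegral (μ : Measure (EuclideanSpace ℝ (Fin d)))
    (fun x => maxCov (condLaw π x) (gaussianLaw d))

/-- The value of the static martingale problem: the supremum of the objective over all
martingale couplings. -/
def martValue (μ ν : ProbabilityMeasure (EuclideanSpace ℝ (Fin d))) : EReal :=
  ⨆ π ∈ martingaleCouplings μ ν, martCost μ π

/-- `π` is optimal for the static martingale problem. -/
def IsMartOptimizer (μ ν : ProbabilityMeasure (EuclideanSpace ℝ (Fin d)))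
    (π : ProbabilityMeasure (EuclideanSpace ℝ (Fin d) × EuclideanSpace ℝ (Fin d))) : Prop :=
  π ∈ martingaleCouplings μ ν ∧ martCost μ π = martValue μ ν

/-- The quadratic Wasserstein distance. -/
def wasserstein2 (m n : ProbabilityMeasure (EuclideanSpace ℝ (Fin d))) : ℝ≥0∞ :=
  (⨅ q ∈ couplings m n, ∫⁻ p, edist p.1 p.2 ^ 2
    ∂(q : Measure (EuclideanSpace ℝ (Fin d) × EuclideanSpace ℝ (Fin d)))) ^ (1 / 2 : ℝ)

/-- Pairs `(m, m')` with `mean(m) = x`, `mean(m') = x'` and `(m + m') / 2 = (p + p') / 2`. -/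
def twoPointFeasible (x x' : EuclideanSpace ℝ (Fin d))
    (p p' : ProbabilityMeasure (EuclideanSpace ℝ (Fin d))) :
    Set (ProbabilityMeasure (EuclideanSpace ℝ (Fin d)) ×
      ProbabilityMeasure (EuclideanSpace ℝ (Fin d))) :=
  {m | HasMean m.1 x ∧ HasMean m.2 x' ∧
    (m.1 : Measure (EuclideanSpace ℝ (Fin d))) + (m.2 : Measure (EuclideanSpace ℝ (Fin d))) =
      (p : Measure (EuclideanSpace ℝ (Fin d))) + (p' : Measure (EuclideanSpace ℝ (Fin d)))}

/-- The cost `W₂(m, γ^d)² + W₂(m', γ^d)²`. -/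
def twoPointCost (m : ProbabilityMeasure (EuclideanSpace ℝ (Fin d)) ×
    ProbabilityMeasure (EuclideanSpace ℝ (Fin d))) : ℝ≥0∞ :=
  wasserstein2 m.1 (gaussianLaw d) ^ 2 + wasserstein2 m.2 (gaussianLaw d) ^ 2

/-- The value of the two-point problem. -/
def twoPointValue (x x' : EuclideanSpace ℝ (Fin d))
    (p p' : ProbabilityMeasure (EuclideanSpace ℝ (Fin d))) : ℝ≥0∞ :=
  ⨅ m ∈ twoPointFeasible x x' p p', twoPointCost m

/-- The two-step martingale `(δ_x p + δ_{x'} p') / 2`, given by its pair `(p, p')` of conditional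
laws, is optimal for the two-point problem with terminal marginal `(p + p') / 2`: it is feasible
and attains the infimum. -/
def IsTwoPointOptimal (x x' : EuclideanSpace ℝ (Fin d))
    (p p' : ProbabilityMeasure (EuclideanSpace ℝ (Fin d))) : Prop :=
  (p, p') ∈ twoPointFeasible x x' p p' ∧ twoPointCost (p, p') = twoPointValue x x' p p'

end Euclidean

end

end WeakTransport

namespace WeakTransport

section

open Set Filter Topology

/-! Part (a) is a perturbation argument with randomized conditional laws. Call (x, x', m, m')
improving if replacing (κ x, κ x') by (m, m') keeps the sum and lowers the cost. Suppose no μ-null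
set meets all improving pairs (x, x'). A Kellerer-type dichotomy
(`exists_null_cover_or_exists_measure`) then yields a nonzero finite measure γ on improving
quadruples whose two marginals on X are dominated by μ. After halving γ, its mass is taken away from
(x, κ x), (x', κ x') and put back at (x, m), (x', m'). The result is a measure on X × 𝒫(Y) with
first marginal μ, the same average law on Y and a strictly smaller cost
(`measure_eq_zero_of_improving`). Replacing its conditional laws on 𝒫(Y) by their barycenters gives
a competing kernel, which by Jensen's inequality for convex lower semicontinuous functions of laws
costs no more (`integral_le_of_randomized`). This contradicts optimality. Since γ lives on
quadruples, (m, m') need not be selected measurably from (x, x').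

The dichotomy rests on `coverNumber`, which behaves like a Choquet capacity: exchanging
intersections and unions of covers makes it continuous along increasing sequences. The
capacitability argument on Baire space then finds a compact set of positive cover number, and on a
compact set Hahn–Banach and Riesz representation produce γ.

Part (b) applies (a) to the cost |y|² + |y - b|², minimized over couplings with the Gaussian, and
set to ⊤ when the mean is wrong. For finite second moments this equals 2|y|² + |b|² - 2 y·b in the
mean, and the second moments of π_x integrate to that of ν, so maximal covariance means minimal
cost. In the two-point problem the second moments have a fixed sum and cancel, which leaves 𝒲₂². The
extra |y|² keeps the mean constraint closed under weak limits on sublevel sets, hence the cost lower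
semicontinuous. -/

theorem measurable_law_apply {Y : Type*} [MeasurableSpace Y] {s : Set Y} (hs : MeasurableSet s) :
    Measurable fun m : ProbabilityMeasure Y => (m : Measure Y) s :=
  (Measure.measurable_coe hs).comp measurable_subtype_coe

/-! ### Measurability of the weak topology on laws -/

section LawSpace

/-- A countable family of open sets, closed under finite unions, whose increasing unions give all
open sets. -/
theorem exists_countable_open_family (Y : Type*) [TopologicalSpace Y]
    [SecondCountableTopology Y] :
    ∃ 𝒰 : Set (Set Y), 𝒰.Countable ∧ (∀ U ∈ 𝒰, IsOpen U) ∧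
      ∀ G : Set Y, IsOpen G → ∃ V : ℕ → Set Y, Monotone V ∧ (∀ n, V n ∈ 𝒰) ∧ ⋃ n, V n = G := by
  classical
  obtain ⟨b, hbc, -, hb⟩ := TopologicalSpace.exists_countable_basis Y
  refine ⟨sUnion '' {S : Set (Set Y) | S ⊆ b ∧ S.Finite}, ?_, ?_, ?_⟩
  · have := Set.countable_ofPred_finite_subset hbc
    refine (this.mono ?_).image _
    exact fun S hS => ⟨hS.2, hS.1⟩
  · rintro _ ⟨S, hS, rfl⟩
    exact isOpen_sUnion fun s hs => hb.isOpen (hS.1 hs)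
  · intro G hG
    obtain ⟨S, hSb, rfl⟩ := hb.open_eq_sUnion hG
    rcases S.eq_empty_or_nonempty with rfl | hne
    · exact ⟨fun _ => ∅, monotone_const, fun n => ⟨∅, by simp, by simp⟩, by simp⟩
    obtain ⟨f, hf⟩ := (hbc.mono hSb).exists_eq_range hne
    refine ⟨fun n => ⋃₀ (f '' Set.Iio n), ?_, fun n => ⟨f '' Set.Iio n, ⟨?_, ?_⟩, rfl⟩, ?_⟩
    · intro m n hmn
      exact sUnion_subset_sUnion (image_mono (Iio_subset_Iio hmn))
    · rintro _ ⟨i, -, rfl⟩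
      exact hSb (hf ▸ mem_range_self i)
    · exact (finite_Iio n).image f
    · ext y
      simp only [mem_iUnion, mem_sUnion, mem_image, mem_Iio, hf, mem_range]
      constructor
      · rintro ⟨n, _, ⟨i, -, rfl⟩, hy⟩
        exact ⟨_, ⟨i, rfl⟩, hy⟩
      · rintro ⟨_, ⟨i, rfl⟩, hy⟩
        exact ⟨i + 1, _, ⟨i, i.lt_succ_self, rfl⟩, hy⟩

variable {Y : Type*} [TopologicalSpace Y] [MeasurableSpace Y]

/-- Portmanteau tested on countably many open sets: every open set is an increasing union of members
of the family, and m₀ is continuous from below. -/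
theorem tendsto_law_of_countable_family [HasOuterApproxClosed Y] [BorelSpace Y] {𝒰 : Set (Set Y)}
    (h𝒰 : ∀ G : Set Y, IsOpen G → ∃ V : ℕ → Set Y, Monotone V ∧ (∀ n, V n ∈ 𝒰) ∧ ⋃ n, V n = G)
    {ι : Type*} {L : Filter ι} [L.IsCountablyGenerated] {m : ι → ProbabilityMeasure Y}
    {m₀ : ProbabilityMeasure Y}
    (h : ∀ U ∈ 𝒰, (m₀ : Measure Y) U ≤ L.liminf fun i => (m i : Measure Y) U) :
    Tendsto m L (𝓝 m₀) := by
  refine tendsto_of_forall_isOpen_le_liminf' fun G hG => ?_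
  obtain ⟨V, hV, hmem, rfl⟩ := h𝒰 G hG
  rw [hV.measure_iUnion]
  refine iSup_le fun n => (h _ (hmem n)).trans ?_
  exact liminf_le_liminf (Eventually.of_forall fun i => measure_mono (subset_iUnion V n))

/-- The σ-algebra on laws is generated by evaluations at measurable sets. Weakly open sets belong to
it because each is a countable union of finite intersections of sets `B p`. This is what makes lower
semicontinuous functions of laws measurable. -/
instance opensMeasurableSpace_law [HasOuterApproxClosed Y] [SecondCountableTopology Y]
    [BorelSpace Y] : OpensMeasurableSpace (ProbabilityMeasure Y) := by
  obtain ⟨𝒰, hc, ho, h𝒰⟩ := exists_countable_open_family Y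
  refine ⟨MeasurableSpace.generateFrom_le fun O hO => ?_⟩
  change IsOpen O at hO
  have : Countable 𝒰 := hc.to_subtype
  let B : 𝒰 × ℚ → Set (ProbabilityMeasure Y) :=
    fun p => {m | ENNReal.ofReal p.2 < (m : Measure Y) p.1}
  have hB : ∀ p, MeasurableSet (B p) := fun p =>
    measurableSet_lt measurable_const (measurable_law_apply (ho _ p.1.2).measurableSet)
  have key : O = ⋃ S ∈ {S : Finset (𝒰 × ℚ) | ⋂ p ∈ S, B p ⊆ O}, ⋂ p ∈ S, B p := by
    refine Subset.antisymm (fun m₀ hm₀ => ?_) (iUnion₂_subset fun S hS => hS)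
    -- The filter generated by the countably many `B p` containing m₀ converges to m₀, so it
    -- contains O; hence some finite intersection of these sets already lies in O.
    let T : Set (𝒰 × ℚ) := {p | m₀ ∈ B p}
    let F : Filter (ProbabilityMeasure Y) := ⨅ p : T, 𝓟 (B p)
    have hF : Tendsto id F (𝓝 m₀) := by
      refine tendsto_law_of_countable_family h𝒰 fun U hU => ?_
      refine le_of_forall_lt_imp_le_of_dense fun a ha => ?_
      obtain ⟨q, hq0, haq, hqU⟩ := ENNReal.lt_iff_exists_rat_btwn.1 ha
      refine le_liminf_of_le (by isBoundedDefault) ?_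
      have hp : (⟨⟨U, hU⟩, q⟩ : 𝒰 × ℚ) ∈ T := by simpa [T, B, ENNReal.ofReal] using hqU
      have : B ⟨⟨U, hU⟩, q⟩ ∈ F :=
        mem_iInf_of_mem (⟨_, hp⟩ : T) (mem_principal_self _)
      filter_upwards [this] with m hm
      exact haq.le.trans (le_of_lt (by simpa [B, ENNReal.ofReal] using hm))
    have hOF : O ∈ F := hF (hO.mem_nhds hm₀)
    obtain ⟨S, hS⟩ := (mem_iInf_finite _).1 hOF
    refine mem_iUnion₂.2 ⟨S.map (Function.Embedding.subtype _), ?_, ?_⟩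
    · intro m hm
      have : (⨅ p ∈ S, 𝓟 (B p)) = 𝓟 (⋂ p ∈ S, B p) := by
        rw [iInf_principal_finset]
      rw [this, mem_principal] at hS
      refine hS ?_
      simp only [Finset.mem_map, Function.Embedding.coe_subtype, mem_iInter] at hm ⊢
      exact fun p hp => hm _ ⟨p, hp, rfl⟩
    · simp only [Finset.mem_map, Function.Embedding.coe_subtype, mem_iInter]
      rintro _ ⟨p, -, rfl⟩
      exact p.2
  rw [key]
  exact MeasurableSet.biUnion (Set.to_countable _) fun S _ =>
    MeasurableSet.biInter S.countable_toSet fun p _ => hB p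

end LawSpace

/-! ### The space of laws is standard Borel -/

theorem standardBorelSpace_of_retract {A Q : Type*} [MeasurableSpace A] [MeasurableSpace Q]
    [StandardBorelSpace Q] {i : A → Q} {r : Q → A} (hi : Measurable i) (hr : Measurable r)
    (hri : Function.LeftInverse r i) : StandardBorelSpace A := by
  -- The image of i is the fixed-point set of i ∘ r, hence measurable without any appeal to
  -- injective images.
  have hrange : range i = {q | i (r q) = q} := by
    ext q
    constructor
    · rintro ⟨a, rfl⟩
      exact congrArg i (hri a)
    · intro hq
      exact ⟨r q, hq⟩
  have hms : MeasurableSet (range i) := by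
    rw [hrange]
    exact measurableSet_eq_fun (hi.comp hr) measurable_id
  have hemb : MeasurableEmbedding i := MeasurableEmbedding.of_measurable_inverse hi hms hr hri
  have := hms.standardBorel
  let e := hemb.equivRange
  let := upgradeStandardBorel (range i)
  let : TopologicalSpace A := TopologicalSpace.induced e inferInstance
  have hA : PolishSpace A := e.toEquiv.polishSpace_induced
  refine ⟨⟨inferInstance, ⟨?_⟩, hA⟩⟩
  rw [← e.measurableEmbedding.comap_eq]
  exact (congrArg (MeasurableSpace.comap (e : A → range i))
    (eq_borel_upgradeStandardBorel (range i))).trans borel_comap.symm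

theorem measurable_law_iff {A Y : Type*} [MeasurableSpace A] [MeasurableSpace Y]
    {f : A → ProbabilityMeasure Y} :
    Measurable f ↔ Measurable fun a => (f a : Measure Y) :=
  ⟨fun h => measurable_subtype_coe.comp h, fun h => h.subtype_mk⟩

/-- After embedding Y in ℝ, a law is recovered from the values of its distribution function at the
rationals, so laws form a measurable retract of ℚ → ℝ. This permits disintegration along 𝒫(Y) and
makes the set of improving quadruples standard Borel. -/
instance standardBorelSpace_law {Y : Type*} [MeasurableSpace Y] [StandardBorelSpace Y] :
    StandardBorelSpace (ProbabilityMeasure Y) := by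
  rcases isEmpty_or_nonempty Y with hY | hY
  · have : IsEmpty (ProbabilityMeasure Y) := ⟨fun m => hY.elim (m.nonempty).some⟩
    infer_instance
  let e := embeddingReal Y
  have he : MeasurableEmbedding e := measurableEmbedding_embeddingReal Y
  let i : ProbabilityMeasure Y → ℚ → ℝ := fun m q => cdf ((m : Measure Y).map e) q
  let η : Kernel (ℚ → ℝ) ℝ :=
    ⟨fun f => (stieltjesOfMeasurableRat (id : (ℚ → ℝ) → ℚ → ℝ) measurable_id f).measure,
      measurable_measure_stieltjesOfMeasurableRat _⟩
  have hη : IsMarkovKernel η := ⟨fun f => by dsimp [η]; infer_instance⟩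
  -- The retraction must be total: `stieltjesOfMeasurableRat` replaces sequences that are not
  -- distribution functions by a default, and `borelMarkovFromReal` does the same for laws not
  -- carried by the image of Y.
  let r : (ℚ → ℝ) → ProbabilityMeasure Y := fun f =>
    kernelLaw (Kernel.borelMarkovFromReal Y η) f
  have hi : Measurable i := by
    refine measurable_pi_iff.2 fun q => ?_
    have : ∀ m : ProbabilityMeasure Y, i m q = ((m : Measure Y) (e ⁻¹' Iic (q : ℝ))).toReal := by
      intro m
      have : IsProbabilityMeasure ((m : Measure Y).map e) :=
        Measure.isProbabilityMeasure_map he.measurable.aemeasurable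
      simp only [i]
      rw [cdf_eq_real, Measure.real, Measure.map_apply he.measurable measurableSet_Iic]
    simp_rw [this]
    exact (measurable_law_apply (he.measurable measurableSet_Iic)).ennreal_toReal
  have hr : Measurable r := measurable_law_iff.2 (Kernel.borelMarkovFromReal Y η).measurable
  refine standardBorelSpace_of_retract hi hr fun m => ?_
  have hm : IsProbabilityMeasure ((m : Measure Y).map e) :=
    Measure.isProbabilityMeasure_map he.measurable.aemeasurable
  have hηi : η (i m) = (m : Measure Y).map e := by
    have hpt : IsRatStieltjesPoint (id : (ℚ → ℝ) → ℚ → ℝ) (i m) :=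
      { mono := fun a b hab => monotone_cdf _ (by exact_mod_cast hab)
        tendsto_atTop_one := (tendsto_cdf_atTop _).comp (tendsto_ratCast_atTop_iff.2 tendsto_id)
        tendsto_atBot_zero := (tendsto_cdf_atBot _).comp (tendsto_ratCast_atBot_iff.2 tendsto_id)
        iInf_rat_gt_eq := fun t => by
          refine Eq.trans ?_ (StieltjesFunction.iInf_rat_gt_eq (cdf ((m : Measure Y).map e)) t)
          refine (Equiv.subtypeEquivRight fun q => ?_).iInf_congr fun q => rfl
          simp }
    have hst : stieltjesOfMeasurableRat (id : (ℚ → ℝ) → ℚ → ℝ) measurable_id (i m) =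
        cdf ((m : Measure Y).map e) := by
      ext x
      rw [← StieltjesFunction.iInf_rat_gt_eq, ← StieltjesFunction.iInf_rat_gt_eq]
      refine iInf_congr fun q => ?_
      rw [stieltjesOfMeasurableRat_eq, toRatCDF_of_isRatStieltjesPoint hpt]
      rfl
    change (stieltjesOfMeasurableRat _ _ (i m)).measure = _
    rw [hst, measure_cdf]
  apply Subtype.ext
  change Kernel.borelMarkovFromReal Y η (i m) = m
  rw [Kernel.borelMarkovFromReal_apply, hηi, if_pos]
  · exact he.comap_map _
  · rw [he.map_apply]
    simp [e]

/-! ### Jensen's inequality for functions of laws -/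

section Jensen

/-- The arithmetic mean of the first `n + 1` terms of a sequence of laws. -/
noncomputable def meanLaw {Y : Type*} [MeasurableSpace Y] (m : ℕ → ProbabilityMeasure Y) (n : ℕ) :
    ProbabilityMeasure Y :=
  ⟨((n : ℝ≥0) + 1)⁻¹ • ∑ i ∈ Finset.range (n + 1), (m i : Measure Y), ⟨by
    have h : ((n : ℝ≥0) + 1) ≠ 0 := by positivity
    simp only [Measure.smul_apply, Measure.coe_finsetSum, Finset.sum_apply, measure_univ,
      Finset.sum_const, Finset.card_range, nsmul_eq_mul, mul_one]
    rw [ENNReal.smul_def, smul_eq_mul, ENNReal.coe_inv h]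
    push_cast
    exact ENNReal.inv_mul_cancel (by simp) (by finiteness)⟩⟩

variable {Y : Type*} [MeasurableSpace Y]

theorem coe_meanLaw (m : ℕ → ProbabilityMeasure Y) (n : ℕ) :
    (meanLaw m n : Measure Y) =
      ((n : ℝ≥0) + 1)⁻¹ • ∑ i ∈ Finset.range (n + 1), (m i : Measure Y) := rfl

theorem meanLaw_apply (m : ℕ → ProbabilityMeasure Y) (n : ℕ) (s : Set Y) :
    (meanLaw m n : Measure Y) s = ENNReal.ofReal (((n : ℝ) + 1)⁻¹ *
      ∑ i ∈ Finset.range (n + 1), (m i : Measure Y).real s) := by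
  have h : ((n : ℝ≥0) + 1) ≠ 0 := by positivity
  rw [coe_meanLaw, Measure.smul_apply, Measure.coe_finsetSum, Finset.sum_apply,
    ENNReal.ofReal_mul (by positivity), ENNReal.ofReal_sum_of_nonneg (fun _ _ => by positivity),
    ENNReal.smul_def, smul_eq_mul]
  congr 1
  · rw [ENNReal.ofReal, Real.toNNReal_inv, Real.toNNReal_add (by positivity) (by simp)]
    simp
  · exact Finset.sum_congr rfl fun i _ => by simp [Measure.real]

/-- Two-point convexity is iterated: the mean of n + 2 laws combines the mean of the first n + 1
with the last one, with weights (n + 1)/(n + 2) and 1/(n + 2). -/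
theorem ConvexOnLaws.meanLaw_le {F : ProbabilityMeasure Y → EReal} (hF : ConvexOnLaws F)
    {m : ℕ → ProbabilityMeasure Y} (htop : ∀ i, F (m i) ≠ ⊤) (hbot : ∀ i, F (m i) ≠ ⊥) (n : ℕ) :
    F (meanLaw m n) ≤
      ((((n : ℝ) + 1)⁻¹ * ∑ i ∈ Finset.range (n + 1), (F (m i)).toReal : ℝ) : EReal) := by
  induction n with
  | zero =>
    have : meanLaw m 0 = m 0 := by
      apply Subtype.ext
      change (meanLaw m 0 : Measure Y) = m 0
      rw [coe_meanLaw]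
      simp
    rw [this]
    simp [EReal.coe_toReal (htop 0) (hbot 0)]
  | succ n ih =>
    have h1 : ((n : ℝ≥0) + 1) ≠ 0 := by positivity
    have h2 : ((n : ℝ≥0) + 2) ≠ 0 := by positivity
    have hab : ((n : ℝ≥0) + 1) / (n + 2) + 1 / (n + 2) = 1 := by
      field_simp
      ring
    have hm : (meanLaw m (n + 1) : Measure Y) =
        (((n : ℝ≥0) + 1) / (n + 2)) • (meanLaw m n : Measure Y) +
          ((1 : ℝ≥0) / (n + 2)) • (m (n + 1) : Measure Y) := by
      rw [coe_meanLaw, coe_meanLaw, Finset.sum_range_succ, smul_add, smul_smul]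
      congr 2
      · push_cast
        field_simp
        ring
      · push_cast
        rw [one_div, add_assoc]
        norm_num
    refine (hF _ _ _ _ _ hab hm).trans ?_
    rw [← EReal.coe_toReal (htop (n + 1)) (hbot (n + 1))]
    refine (add_le_add_left (mul_le_mul_of_nonneg_left ih (by positivity)) _).trans ?_
    rw [← EReal.coe_mul, ← EReal.coe_mul, ← EReal.coe_add, EReal.coe_le_coe_iff,
      Finset.sum_range_succ _ (n + 1)]
    push_cast
    apply le_of_eq
    field_simp
    ring

variable [TopologicalSpace Y] [PolishSpace Y] [BorelSpace Y]

/-- The strong law of large numbers for a real function of an i.i.d. sequence. -/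
theorem tendsto_mean_of_iid {Ω A : Type*} [MeasurableSpace Ω] [MeasurableSpace A] {P : Measure Ω}
    {ρ : Measure A} {X : ℕ → Ω → A} (hX : ∀ i, Measurable (X i)) (hlaw : ∀ i, HasLaw (X i) ρ P)
    (hindep : iIndepFun X P) {f : A → ℝ} (hf : Measurable f) (hint : Integrable f ρ) :
    ∀ᵐ ω ∂P, Tendsto (fun n : ℕ => ((n : ℝ) + 1)⁻¹ * ∑ i ∈ Finset.range (n + 1), f (X i ω)) atTop
      (𝓝 (∫ a, f a ∂ρ)) := by
  have hmap : ∀ i, P.map (X i) = ρ := fun i => (hlaw i).map_eq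
  have h0 : Integrable (fun ω => f (X 0 ω)) P := by
    refine Integrable.comp_measurable (f := X 0) ?_ (hX 0)
    rwa [hmap 0]
  have := strong_law_ae (fun i ω => f (X i ω)) h0
    (fun i j hij => (hindep.indepFun hij).comp hf hf)
    (fun i => IdentDistrib.comp ⟨(hX i).aemeasurable, (hX 0).aemeasurable, by
      rw [hmap, hmap]⟩ hf)
  filter_upwards [this] with ω hω
  have hlim := hω.comp (tendsto_add_atTop_nat 1)
  rw [← hmap 0, integral_map (hX 0).aemeasurable hf.aestronglyMeasurable]
  refine hlim.congr fun n => ?_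
  simp

/-- **Jensen's inequality** on the space of laws. -/
theorem ConvexOnLaws.map_barycenter_le {F : ProbabilityMeasure Y → EReal} (hF : ConvexOnLaws F)
    (hlsc : LowerSemicontinuous F) (hbot : ∀ m, F m ≠ ⊥) {ρ : Measure (ProbabilityMeasure Y)}
    [IsProbabilityMeasure ρ] (htop : ∀ᵐ m ∂ρ, F m ≠ ⊤)
    (hint : Integrable (fun m => (F m).toReal) ρ) {b : ProbabilityMeasure Y}
    (hb : ∀ s, MeasurableSet s → (b : Measure Y) s = ∫⁻ m, (m : Measure Y) s ∂ρ) :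
    F b ≤ ((∫ m, (F m).toReal ∂ρ : ℝ) : EReal) := by
  let := TopologicalSpace.upgradeIsCompletelyMetrizable Y
  obtain ⟨Ω, _, P, X, hX, hlaw, hindep, hP⟩ := exists_iid ℕ ρ
  have hFm : Measurable fun m => (F m).toReal := hlsc.measurable.ereal_toReal
  have hlim := tendsto_mean_of_iid hX hlaw hindep hFm hint
  obtain ⟨𝒰, hc, ho, h𝒰⟩ := exists_countable_open_family Y
  have hU : ∀ᵐ ω ∂P, ∀ U ∈ 𝒰,
      Tendsto (fun n : ℕ => (meanLaw (fun i => X i ω) n : Measure Y) U) atTop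
        (𝓝 ((b : Measure Y) U)) := by
    refine (ae_ball_iff hc).2 fun U hU => ?_
    have hUm := (ho U hU).measurableSet
    have hm : Measurable fun m : ProbabilityMeasure Y => (m : Measure Y).real U :=
      (measurable_law_apply hUm).ennreal_toReal
    have hi : Integrable (fun m : ProbabilityMeasure Y => (m : Measure Y).real U) ρ :=
      Integrable.of_bound hm.aestronglyMeasurable 1 (Eventually.of_forall fun m => by
        simp)
    filter_upwards [tendsto_mean_of_iid hX hlaw hindep hm hi] with ω hω
    have hbU : (b : Measure Y) U = ENNReal.ofReal (∫ m : ProbabilityMeasure Y,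
        (m : Measure Y).real U ∂ρ) := by
      rw [ofReal_integral_eq_lintegral_ofReal hi (Eventually.of_forall fun m => by positivity),
        hb U hUm]
      simp
    simp_rw [meanLaw_apply, hbU]
    exact ENNReal.tendsto_ofReal hω
  have hfin : ∀ᵐ ω ∂P, ∀ i, F (X i ω) ≠ ⊤ := by
    refine ae_all_iff.2 fun i => ?_
    rw [← (hlaw i).map_eq] at htop
    exact ae_of_ae_map (hX i).aemeasurable htop
  -- By the law of large numbers some sample has empirical means converging weakly to the barycenter
  -- b and averages of F converging to the integral. Finite convexity along the sample and lower
  -- semicontinuity at b then conclude.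
  obtain ⟨ω, h1, h2, h3⟩ := (hlim.and (hU.and hfin)).exists
  have hconv : Tendsto (meanLaw fun i => X i ω) atTop (𝓝 b) :=
    tendsto_law_of_countable_family h𝒰 fun U hU => (h2 U hU).liminf_eq.ge
  by_contra! hlt
  obtain ⟨y, hy1, hy2⟩ := exists_between hlt
  have e1 : ∀ᶠ n in atTop, y < F (meanLaw (fun i => X i ω) n) := hconv.eventually (hlsc b y hy2)
  have e2 := (((continuous_coe_real_ereal.tendsto _).comp h1).eventually (gt_mem_nhds hy1))
  obtain ⟨n, hn1, hn2⟩ := (e1.and e2).exists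
  exact absurd (hF.meanLaw_le h3 (fun i => hbot _) n) (not_le.2 (hn2.trans hn1))

end Jensen

/-! ### The cover number and its continuity along increasing sets -/

section CoverNumber

variable {W X Z : Type*} [MeasurableSpace X] [MeasurableSpace Z]

/-- The least total mass of a pair `(A, B)` such that every `w ∈ E` has `g₁ w ∈ A` or
`g₂ w ∈ B`. -/
noncomputable def coverNumber (μ : Measure X) (ν : Measure Z) (g₁ : W → X) (g₂ : W → Z)
    (E : Set W) : ℝ≥0∞ :=
  ⨅ (p : Set X × Set Z) (_ : MeasurableSet p.1 ∧ MeasurableSet p.2 ∧ E ⊆ g₁ ⁻¹' p.1 ∪ g₂ ⁻¹' p.2),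
    μ p.1 + ν p.2

variable {μ : Measure X} {ν : Measure Z} {g₁ : W → X} {g₂ : W → Z} {E : Set W}

theorem coverNumber_le {A : Set X} {B : Set Z} (hA : MeasurableSet A) (hB : MeasurableSet B)
    (h : E ⊆ g₁ ⁻¹' A ∪ g₂ ⁻¹' B) : coverNumber μ ν g₁ g₂ E ≤ μ A + ν B :=
  iInf₂_le (A, B) ⟨hA, hB, h⟩

theorem coverNumber_lt_top [IsFiniteMeasure μ] : coverNumber μ ν g₁ g₂ E < ⊤ :=
  (coverNumber_le MeasurableSet.univ MeasurableSet.empty (by simp)).trans_lt (by simp)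

theorem exists_cover_le [IsFiniteMeasure μ] {ε : ℝ≥0∞} (hε : ε ≠ 0) :
    ∃ A B, MeasurableSet A ∧ MeasurableSet B ∧ E ⊆ g₁ ⁻¹' A ∪ g₂ ⁻¹' B ∧
      μ A + ν B ≤ coverNumber μ ν g₁ g₂ E + ε := by
  have h := ENNReal.lt_add_right (coverNumber_lt_top (μ := μ) (ν := ν) (g₁ := g₁) (g₂ := g₂)
    (E := E)).ne hε
  nth_rw 1 [coverNumber] at h
  simp only [iInf_lt_iff] at h
  obtain ⟨⟨A, B⟩, hp, hlt⟩ := h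
  exact ⟨A, B, hp.1, hp.2.1, hp.2.2, hlt.le⟩

theorem measure_biUnion_add_biInter_le [IsFiniteMeasure μ] {E : ℕ → Set W} (hE : Monotone E)
    {c : ℝ≥0∞} (hc : ∀ n, coverNumber μ ν g₁ g₂ (E n) ≤ c) {A : ℕ → Set X} {B : ℕ → Set Z}
    (hA : ∀ n, MeasurableSet (A n)) (hB : ∀ n, MeasurableSet (B n))
    (hcov : ∀ n, E n ⊆ g₁ ⁻¹' A n ∪ g₂ ⁻¹' B n)
    (hle : ∀ n, μ (A n) + ν (B n) ≤ coverNumber μ ν g₁ g₂ (E n) + 2⁻¹ ^ n) (j n : ℕ) :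
    μ (⋃ i < j + 1, A (n + i)) + ν (⋂ i < j + 1, B (n + i)) ≤ c + 2 * 2⁻¹ ^ n := by
  induction j generalizing n with
  | zero =>
    simp only [zero_add, Nat.lt_one_iff, iUnion_iUnion_eq_left, iInter_iInter_eq_left, add_zero]
    refine (hle n).trans (add_le_add (hc n) ?_)
    rw [two_mul]
    exact le_self_add
  | succ j ih =>
    have e1 : (⋃ i < j + 1 + 1, A (n + i)) = A n ∪ ⋃ i < j + 1, A (n + 1 + i) := by
      rw [biUnion_lt_succ']
      simp only [add_zero, add_assoc, add_comm 1]
    have e2 : (⋂ i < j + 1 + 1, B (n + i)) = B n ∩ ⋂ i < j + 1, B (n + 1 + i) := by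
      rw [biInter_lt_succ']
      simp only [add_zero, add_assoc, add_comm 1]
    rw [e1, e2]
    set A' := ⋃ i < j + 1, A (n + 1 + i)
    set B' := ⋂ i < j + 1, B (n + 1 + i)
    have hA' : MeasurableSet A' := MeasurableSet.iUnion fun i => MeasurableSet.iUnion fun _ => hA _
    have hB' : MeasurableSet B' := MeasurableSet.iInter fun i => MeasurableSet.iInter fun _ => hB _
    -- The exchange step. The pair (A ∩ A', B ∪ B') still covers `E n`, so its mass is at least the
    -- cover number; by modularity of the measures, the opposite pair (A ∪ A', B ∩ B') cannot exceed
    -- the two original masses minus that number. The errors 2⁻ⁱ for i ≥ n sum to 2 · 2⁻ⁿ.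
    have hmeet : E n ⊆ g₁ ⁻¹' (A n ∩ A') ∪ g₂ ⁻¹' (B n ∪ B') := by
      intro w hw
      by_cases h2 : g₂ w ∈ B n ∪ B'
      · exact Or.inr h2
      · refine Or.inl ⟨(hcov n hw).resolve_right fun h => h2 (Or.inl h), ?_⟩
        have : g₂ w ∉ B' := fun h => h2 (Or.inr h)
        simp only [B', mem_iInter, not_forall] at this
        obtain ⟨i, hi, hiB⟩ := this
        have := (hcov (n + 1 + i) (hE (by omega) hw)).resolve_right hiB
        exact mem_iUnion₂.2 ⟨i, hi, this⟩
    have hge := coverNumber_le (μ := μ) (ν := ν) ((hA n).inter hA') ((hB n).union hB') hmeet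
    have hμ := measure_union_add_inter (μ := μ) (A n) hA'
    have hν := measure_union_add_inter (μ := ν) (B n) hB'
    refine ENNReal.le_of_add_le_add_left
      (coverNumber_lt_top (μ := μ) (ν := ν) (g₁ := g₁) (g₂ := g₂) (E := E n)).ne ?_
    calc coverNumber μ ν g₁ g₂ (E n) + (μ (A n ∪ A') + ν (B n ∩ B'))
        ≤ μ (A n ∩ A') + ν (B n ∪ B') + (μ (A n ∪ A') + ν (B n ∩ B')) := by gcongr
      _ = (μ (A n ∪ A') + μ (A n ∩ A')) + (ν (B n ∪ B') + ν (B n ∩ B')) := by ring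
      _ = (μ (A n) + ν (B n)) + (μ A' + ν B') := by rw [hμ, hν]; ring
      _ ≤ (coverNumber μ ν g₁ g₂ (E n) + 2⁻¹ ^ n) + (c + 2 * 2⁻¹ ^ (n + 1)) :=
        add_le_add (hle n) (ih (n + 1))
      _ = coverNumber μ ν g₁ g₂ (E n) + (c + 2 * 2⁻¹ ^ n) := by
        have : (2 : ℝ≥0∞) * 2⁻¹ ^ (n + 1) = 2⁻¹ ^ n := by
          rw [pow_succ, mul_comm _ (2⁻¹ : ℝ≥0∞), ← mul_assoc,
            ENNReal.mul_inv_cancel (by simp) (by simp), one_mul]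
        rw [this]
        ring

/-- The cover number is continuous along increasing sequences of sets. -/
theorem exists_cover_iUnion_le [IsFiniteMeasure μ] {E : ℕ → Set W} (hE : Monotone E)
    {c : ℝ≥0∞} (hc : ∀ n, coverNumber μ ν g₁ g₂ (E n) ≤ c) :
    ∃ A B, MeasurableSet A ∧ MeasurableSet B ∧ (⋃ n, E n) ⊆ g₁ ⁻¹' A ∪ g₂ ⁻¹' B ∧
      μ A + ν B ≤ c := by
  have hex := fun n : ℕ => exists_cover_le (μ := μ) (ν := ν) (g₁ := g₁) (g₂ := g₂) (E := E n)
    (ε := 2⁻¹ ^ n) (by simp)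
  choose A B hA hB hcov hle using hex
  have hfin := measure_biUnion_add_biInter_le hE hc hA hB hcov hle
  have hinf : ∀ n, μ (⋃ i, A (n + i)) + ν (⋂ i, B (n + i)) ≤ c + 2 * 2⁻¹ ^ n := by
    intro n
    have : (⋃ i, A (n + i)) = ⋃ j, ⋃ i < j + 1, A (n + i) := by
      ext x
      simp only [mem_iUnion]
      exact ⟨fun ⟨i, hi⟩ => ⟨i, i, i.lt_succ_self, hi⟩, fun ⟨_, i, _, hi⟩ => ⟨i, hi⟩⟩
    rw [this, Monotone.measure_iUnion, ENNReal.iSup_add]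
    · refine iSup_le fun j => le_trans ?_ (hfin j n)
      gcongr
      exact subset_iInter fun _ => Subset.rfl
    · intro j k hjk
      exact biUnion_mono (fun i (hi : i < j + 1) => lt_of_lt_of_le hi (by omega)) fun _ _ => le_rfl
  have hmono : Monotone fun n => ⋂ i, B (n + i) := by
    intro m n hmn x hx
    simp only [mem_iInter] at hx ⊢
    intro i
    have := hx (n - m + i)
    rwa [show m + (n - m + i) = n + i by omega] at this
  -- The cover is (limsup A, liminf B): a point that is not eventually in the B's is outside
  -- infinitely many of them, and there it must lie in the corresponding A's.
  refine ⟨⋂ n, ⋃ i, A (n + i), ⋃ n, ⋂ i, B (n + i),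
    MeasurableSet.iInter fun n => MeasurableSet.iUnion fun i => hA _,
    MeasurableSet.iUnion fun n => MeasurableSet.iInter fun i => hB _, ?_, ?_⟩
  · intro w hw
    obtain ⟨k, hk⟩ := mem_iUnion.1 hw
    by_cases h2 : g₂ w ∈ ⋃ n, ⋂ i, B (n + i)
    · exact Or.inr h2
    · left
      simp only [mem_iUnion, mem_iInter, not_exists, not_forall] at h2
      simp only [mem_preimage, mem_iInter, mem_iUnion]
      intro n
      obtain ⟨i, hi⟩ := h2 (n + k)
      refine ⟨k + i, ?_⟩
      rw [← add_assoc]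
      exact (hcov (n + k + i) (hE (by omega) hk)).resolve_right hi
  · rw [hmono.measure_iUnion, ENNReal.add_iSup]
    refine iSup_le fun n => ?_
    have hlim : Tendsto (fun m : ℕ => c + 2 * (2⁻¹ : ℝ≥0∞) ^ m) atTop (𝓝 (c + 2 * 0)) := by
      refine tendsto_const_nhds.add (ENNReal.Tendsto.const_mul ?_ (by simp))
      exact ENNReal.tendsto_pow_atTop_nhds_zero_of_lt_one (by simp)
    rw [mul_zero, add_zero] at hlim
    refine ge_of_tendsto hlim (eventually_atTop.2 ⟨n, fun m hm => le_trans ?_ (hinf m)⟩)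
    exact add_le_add (measure_mono (iInter_subset _ m)) (measure_mono (hmono hm))

/-- The continuity result for a constant sequence says that the infimum is attained, so cover number
zero yields an actual null cover. -/
theorem exists_null_cover [IsFiniteMeasure μ] (h : coverNumber μ ν g₁ g₂ E = 0) :
    ∃ A B, MeasurableSet A ∧ MeasurableSet B ∧ E ⊆ g₁ ⁻¹' A ∪ g₂ ⁻¹' B ∧ μ A = 0 ∧ ν B = 0 := by
  obtain ⟨A, B, hA, hB, hcov, hle⟩ := exists_cover_iUnion_le (μ := μ) (ν := ν) (g₁ := g₁)
    (g₂ := g₂) (E := fun _ : ℕ => E) monotone_const (c := 0) fun _ => h.le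
  rw [iUnion_const] at hcov
  exact ⟨A, B, hA, hB, hcov, by simpa using hle⟩

end CoverNumber

/-! ### Capacitability: reduction to a compact subset of Baire space -/

section Baire

theorem isCompact_setOf_le (k : ℕ → ℕ) : IsCompact {x : ℕ → ℕ | ∀ i, x i ≤ k i} := by
  have := isCompact_univ_pi fun i => (finite_Iic (k i)).isCompact
  convert! this using 1
  ext x
  simp [Pi.le_def]

theorem exists_initial_subset_of_isOpen {k : ℕ → ℕ} {O : Set (ℕ → ℕ)} (hO : IsOpen O)
    (h : {x : ℕ → ℕ | ∀ i, x i ≤ k i} ⊆ O) : ∃ j, {x : ℕ → ℕ | ∀ i < j, x i ≤ k i} ⊆ O := by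
  by_contra! hne
  simp only [not_subset] at hne
  choose x hx hxO using hne
  -- The counterexamples x j are bounded by k only in their first j coordinates. Truncation by k
  -- brings them into the compact box without changing any fixed coordinate for large j, so a
  -- subsequence of the x j themselves converges.
  obtain ⟨y, hy, φ, hφ, hlim⟩ := (isCompact_setOf_le k).tendsto_subseq
    (x := fun j i => min (x j i) (k i)) fun j i => min_le_right _ _
  have hlim' : Tendsto (fun n => x (φ n)) atTop (𝓝 y) := by
    rw [tendsto_pi_nhds] at hlim ⊢
    intro i
    refine (hlim i).congr' ?_
    filter_upwards [eventually_gt_atTop i] with n hn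
    exact min_eq_left (hx (φ n) i (hn.trans_le hφ.le_apply))
  obtain ⟨n, hn⟩ := (hlim'.eventually (hO.mem_nhds (h hy))).exists
  exact hxO _ hn

variable {X Z : Type*} [MeasurableSpace X] [MeasurableSpace Z] {μ : Measure X} {ν : Measure Z}
  {g₁ : (ℕ → ℕ) → X} {g₂ : (ℕ → ℕ) → Z}

/-- Bounding coordinate j by a exhausts the current set as a → ∞, so by continuity of the cover
number some bound keeps it above c. The bounds are chosen one coordinate after another. -/
theorem exists_bound_coverNumber_initial [IsFiniteMeasure μ] {c : ℝ≥0∞}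
    (hc : c < coverNumber μ ν g₁ g₂ univ) :
    ∃ k : ℕ → ℕ, ∀ j, c < coverNumber μ ν g₁ g₂ {x | ∀ i < j, x i ≤ k i} := by
  have step : ∀ (k : ℕ → ℕ) (j : ℕ), c < coverNumber μ ν g₁ g₂ {x | ∀ i < j, x i ≤ k i} →
      ∃ a, c < coverNumber μ ν g₁ g₂ ({x | ∀ i < j, x i ≤ k i} ∩ {x | x j ≤ a}) := by
    intro k j hk
    by_contra! hle
    obtain ⟨A, B, hA, hB, hcov, hAB⟩ := exists_cover_iUnion_le (μ := μ) (ν := ν) (g₁ := g₁)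
      (g₂ := g₂) (E := fun a => {x | ∀ i < j, x i ≤ k i} ∩ {x : ℕ → ℕ | x j ≤ a})
      (fun a b hab x hx => ⟨hx.1, le_trans hx.2 hab⟩) hle
    refine absurd (coverNumber_le hA hB fun x hx => hcov ?_) (not_le.2 (hAB.trans_lt hk))
    exact mem_iUnion.2 ⟨x j, hx, le_refl (x j)⟩
  choose! F hF using step
  let s : ℕ → ℕ → ℕ := fun n => Nat.rec (fun _ => 0) (fun j k => Function.update k j (F k j)) n
  have hs : ∀ j, s (j + 1) = Function.update (s j) j (F (s j) j) := fun j => rfl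
  have hP : ∀ j, c < coverNumber μ ν g₁ g₂ {x | ∀ i < j, x i ≤ s j i} := by
    intro j
    induction j with
    | zero => simpa using hc
    | succ j ih =>
      convert hF _ j ih using 2
      ext x
      simp only [mem_ofPred_eq, mem_inter_iff, hs, Nat.lt_succ_iff_lt_or_eq]
      constructor
      · intro h
        refine ⟨fun i hi => ?_, by simpa using h j (Or.inr rfl)⟩
        simpa [Function.update_of_ne hi.ne] using h i (Or.inl hi)
      · rintro ⟨h1, h2⟩ i (hi | rfl)
        · simpa [Function.update_of_ne hi.ne] using h1 i hi
        · simpa using h2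
  have hstab : ∀ j i, i < j → s j i = s (i + 1) i := by
    intro j i hij
    induction j with
    | zero => omega
    | succ j ih =>
      rcases Nat.lt_succ_iff_lt_or_eq.1 hij with h | rfl
      · rw [hs, Function.update_of_ne h.ne, ih h]
      · rfl
  refine ⟨fun i => s (i + 1) i, fun j => ?_⟩
  convert hP j using 3
  ext x
  exact forall₂_congr fun i hi => by rw [hstab j i hi]

theorem exists_isCompact_coverNumber_pos [TopologicalSpace X] [TopologicalSpace Z] [BorelSpace X]
    [BorelSpace Z] [μ.OuterRegular] [ν.OuterRegular] [IsFiniteMeasure μ] [IsFiniteMeasure ν]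
    (hg₁ : Continuous g₁) (hg₂ : Continuous g₂) (h : coverNumber μ ν g₁ g₂ univ ≠ 0) :
    ∃ L : Set (ℕ → ℕ), IsCompact L ∧ coverNumber μ ν g₁ g₂ L ≠ 0 := by
  obtain ⟨c, hc0, hc⟩ := exists_between (pos_iff_ne_zero.2 h)
  obtain ⟨k, hk⟩ := exists_bound_coverNumber_initial hc
  refine ⟨{x | ∀ i, x i ≤ k i}, isCompact_setOf_le k, fun h0 => ?_⟩
  · obtain ⟨A, B, hA, hB, hcov, hA0, hB0⟩ := exists_null_cover h0
    -- A null cover of the compact box is enlarged to open sets of mass at most c/2 each. Their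
    -- preimages cover a box restricted in finitely many coordinates only, whose cover number
    -- exceeds c: a contradiction.
    have hc2 : c / 2 ≠ 0 := by simpa using hc0.ne'
    obtain ⟨U, hAU, hU, hUc⟩ := A.exists_isOpen_le_add μ hc2
    obtain ⟨V, hBV, hV, hVc⟩ := B.exists_isOpen_le_add ν hc2
    obtain ⟨j, hj⟩ := exists_initial_subset_of_isOpen
      ((hU.preimage hg₁).union (hV.preimage hg₂))
      (hcov.trans (union_subset_union (preimage_mono hAU) (preimage_mono hBV)))
    have := coverNumber_le (μ := μ) (ν := ν) hU.measurableSet hV.measurableSet hj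
    refine absurd ((hk j).trans_le this) (not_lt.2 ?_)
    rw [hA0, zero_add] at hUc
    rw [hB0, zero_add] at hVc
    calc μ U + ν V ≤ c / 2 + c / 2 := add_le_add hUc hVc
      _ = c := ENNReal.add_halves c

end Baire

/-! ### Duality on a compact space, and the dichotomy -/

section CompactDuality

/-- Indicators of closed sets are limits of continuous functions with values in [0, 1]; inner
regularity by closed sets extends the inequality to all measurable sets. -/
theorem measure_le_of_forall_integral_le {X : Type*} [TopologicalSpace X] [MeasurableSpace X]
    [BorelSpace X] [TopologicalSpace.PseudoMetrizableSpace X] {γ μ : Measure X} [IsFiniteMeasure γ]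
    [IsFiniteMeasure μ]
    (h : ∀ u : BoundedContinuousFunction X ℝ, 0 ≤ u → ∫ x, u x ∂γ ≤ ∫ x, u x ∂μ) : γ ≤ μ := by
  have hclosed : ∀ F : Set X, IsClosed F → γ F ≤ μ F := by
    intro F hF
    refine le_of_tendsto_of_tendsto' (HasOuterApproxClosed.tendsto_lintegral_apprSeq hF γ)
      (HasOuterApproxClosed.tendsto_lintegral_apprSeq hF μ) fun n => ?_
    have hint : ∀ (η : Measure X) [IsFiniteMeasure η],
        Integrable (fun x => (hF.apprSeq n x : ℝ)) η := fun η _ =>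
      Integrable.of_bound (by fun_prop) 1 (ae_of_all _ fun x => by
        simpa using HasOuterApproxClosed.apprSeq_apply_le_one hF n x)
    rw [lintegral_coe_eq_integral _ (hint γ), lintegral_coe_eq_integral _ (hint μ)]
    refine ENNReal.ofReal_le_ofReal (h (BoundedContinuousFunction.ofNormedAddCommGroup
      (fun x => (hF.apprSeq n x : ℝ)) (by fun_prop) 1 fun x => ?_) fun x => ?_)
    · simpa using HasOuterApproxClosed.apprSeq_apply_le_one hF n x
    · exact NNReal.coe_nonneg _
  refine Measure.le_iff.2 fun s hs => ?_
  rw [hs.measure_eq_iSup_isClosed_of_ne_top (measure_ne_top γ s)]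
  exact iSup₂_le fun F hFs => iSup_le fun hF => (hclosed F hF).trans (measure_mono hFs)

open BoundedContinuousFunction

variable {K X Z : Type*} [TopologicalSpace K]
  [TopologicalSpace X] [MeasurableSpace X] [TopologicalSpace Z] [MeasurableSpace Z]

/-- The values `∫ u dμ + ∫ v dν` over the nonnegative bounded continuous `u`, `v` such that
`u ∘ g₁ + v ∘ g₂` dominates `h`. -/
def dominatingCosts (μ : Measure X) (ν : Measure Z) (g₁ : K → X) (g₂ : K → Z) (h : C(K, ℝ)) :
    Set ℝ :=
  {r | ∃ (u : X →ᵇ ℝ) (v : Z →ᵇ ℝ), 0 ≤ u ∧ 0 ≤ v ∧ (∀ k, h k ≤ u (g₁ k) + v (g₂ k)) ∧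
    r = ∫ x, u x ∂μ + ∫ z, v z ∂ν}

variable {μ : Measure X} {ν : Measure Z} {g₁ : K → X} {g₂ : K → Z}

theorem dominatingCosts_nonneg {h : C(K, ℝ)} {r : ℝ} (hr : r ∈ dominatingCosts μ ν g₁ g₂ h) :
    0 ≤ r := by
  obtain ⟨u, v, hu, hv, -, rfl⟩ := hr
  exact add_nonneg (integral_nonneg fun x => hu x) (integral_nonneg fun z => hv z)

theorem dominatingCosts_nonempty [CompactSpace K] (h : C(K, ℝ)) :
    (dominatingCosts μ ν g₁ g₂ h).Nonempty :=
  ⟨_, const X ‖h‖, 0, fun _ => norm_nonneg h, le_rfl, fun k => by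
    simpa using (le_abs_self _).trans (h.norm_coe_le_norm k), rfl⟩

theorem smul_mem_dominatingCosts {h : C(K, ℝ)} {r c : ℝ} (hc : 0 ≤ c)
    (hr : r ∈ dominatingCosts μ ν g₁ g₂ h) : c * r ∈ dominatingCosts μ ν g₁ g₂ (c • h) := by
  obtain ⟨u, v, hu, hv, hle, rfl⟩ := hr
  refine ⟨c • u, c • v, fun x => mul_nonneg hc (hu x), fun z => mul_nonneg hc (hv z),
    fun k => ?_, ?_⟩
  · have := mul_le_mul_of_nonneg_left (hle k) hc
    simpa [mul_add] using this
  · simp [mul_add, integral_const_mul]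

theorem add_mem_dominatingCosts [OpensMeasurableSpace X] [OpensMeasurableSpace Z]
    [IsFiniteMeasure μ] [IsFiniteMeasure ν] {h h' : C(K, ℝ)} {r r' : ℝ}
    (hr : r ∈ dominatingCosts μ ν g₁ g₂ h) (hr' : r' ∈ dominatingCosts μ ν g₁ g₂ h') :
    r + r' ∈ dominatingCosts μ ν g₁ g₂ (h + h') := by
  obtain ⟨u, v, hu, hv, hle, rfl⟩ := hr
  obtain ⟨u', v', hu', hv', hle', rfl⟩ := hr'
  refine ⟨u + u', v + v', add_nonneg hu hu', add_nonneg hv hv', fun k => ?_, ?_⟩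
  · have := add_le_add (hle k) (hle' k)
    simp only [ContinuousMap.add_apply, BoundedContinuousFunction.coe_add, Pi.add_apply]
    linarith
  · simp only [BoundedContinuousFunction.coe_add, Pi.add_apply]
    rw [integral_add (u.integrable μ) (u'.integrable μ),
      integral_add (v.integrable ν) (v'.integrable ν)]
    ring

/-- The least dominating cost, a sublinear functional. -/
noncomputable def dominatingCost (μ : Measure X) (ν : Measure Z) (g₁ : K → X) (g₂ : K → Z)
    (h : C(K, ℝ)) : ℝ :=
  sInf (dominatingCosts μ ν g₁ g₂ h)

theorem dominatingCost_le {h : C(K, ℝ)} {r : ℝ} (hr : r ∈ dominatingCosts μ ν g₁ g₂ h) :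
    dominatingCost μ ν g₁ g₂ h ≤ r :=
  csInf_le ⟨0, fun _ => dominatingCosts_nonneg⟩ hr

theorem dominatingCost_nonneg (h : C(K, ℝ)) : 0 ≤ dominatingCost μ ν g₁ g₂ h :=
  Real.sInf_nonneg fun _ => dominatingCosts_nonneg

theorem dominatingCost_smul_le [CompactSpace K] {c : ℝ} (hc : 0 < c) (h : C(K, ℝ)) :
    dominatingCost μ ν g₁ g₂ (c • h) ≤ c * dominatingCost μ ν g₁ g₂ h := by
  rw [← div_le_iff₀' hc]
  refine le_csInf (dominatingCosts_nonempty h) fun r hr => ?_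
  rw [div_le_iff₀' hc]
  exact dominatingCost_le (smul_mem_dominatingCosts hc.le hr)

theorem dominatingCost_smul [CompactSpace K] {c : ℝ} (hc : 0 < c) (h : C(K, ℝ)) :
    dominatingCost μ ν g₁ g₂ (c • h) = c * dominatingCost μ ν g₁ g₂ h := by
  refine (dominatingCost_smul_le hc h).antisymm ?_
  have := dominatingCost_smul_le (μ := μ) (ν := ν) (g₁ := g₁) (g₂ := g₂) (inv_pos.2 hc) (c • h)
  rw [smul_smul, inv_mul_cancel₀ hc.ne', one_smul] at this
  rwa [← le_inv_mul_iff₀ hc]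

theorem dominatingCost_add_le [CompactSpace K] [OpensMeasurableSpace X] [OpensMeasurableSpace Z]
    [IsFiniteMeasure μ] [IsFiniteMeasure ν] (h h' : C(K, ℝ)) :
    dominatingCost μ ν g₁ g₂ (h + h') ≤
      dominatingCost μ ν g₁ g₂ h + dominatingCost μ ν g₁ g₂ h' := by
  rw [← sub_le_iff_le_add]
  refine le_csInf (dominatingCosts_nonempty h) fun r hr => ?_
  rw [sub_le_iff_le_add, ← sub_le_iff_le_add']
  refine le_csInf (dominatingCosts_nonempty h') fun r' hr' => ?_
  rw [sub_le_iff_le_add']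
  exact dominatingCost_le (add_mem_dominatingCosts hr hr')

/-- If u ∘ g₁ + v ∘ g₂ ≥ 1, then {u ≥ 1/2} and {v ≥ 1/2} form a cover, and Markov's inequality
bounds its mass by twice the integrals. -/
theorem coverNumber_le_dominatingCost [CompactSpace K] [OpensMeasurableSpace X]
    [OpensMeasurableSpace Z]
    [IsFiniteMeasure μ] [IsFiniteMeasure ν] :
    coverNumber μ ν g₁ g₂ univ ≤ ENNReal.ofReal (2 * dominatingCost μ ν g₁ g₂ 1) := by
  rw [← ENNReal.ofReal_toReal (coverNumber_lt_top (μ := μ) (ν := ν) (g₁ := g₁) (g₂ := g₂)).ne]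
  refine ENNReal.ofReal_le_ofReal ?_
  rw [← div_le_iff₀' two_pos]
  refine le_csInf (dominatingCosts_nonempty 1) fun r hr => ?_
  rw [div_le_iff₀' two_pos]
  obtain ⟨u, v, hu, hv, hle, rfl⟩ := hr
  refine ENNReal.toReal_le_of_le_ofReal (by
    have := integral_nonneg (μ := μ) (f := u) fun x => hu x
    have := integral_nonneg (μ := ν) (f := v) fun x => hv x
    positivity) ?_
  have hcov := coverNumber_le (μ := μ) (ν := ν) (g₁ := g₁) (g₂ := g₂) (E := univ)
    (A := {x | 1 / 2 ≤ u x}) (B := {z | 1 / 2 ≤ v z})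
    (measurableSet_le measurable_const u.continuous.measurable)
    (measurableSet_le measurable_const v.continuous.measurable) (fun k _ => by
      have := hle k
      by_contra hk
      simp only [mem_union, mem_preimage, mem_ofPred_eq, not_or, not_le] at hk
      simp only [ContinuousMap.one_apply] at this
      linarith)
  refine hcov.trans ?_
  have h1 := mul_meas_ge_le_integral_of_nonneg (μ := μ) (f := u)
    (Eventually.of_forall fun x => hu x) (u.integrable μ) (1 / 2)
  have h2 := mul_meas_ge_le_integral_of_nonneg (μ := ν) (f := v)
    (Eventually.of_forall fun x => hv x) (v.integrable ν) (1 / 2)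
  rw [ENNReal.le_ofReal_iff_toReal_le (by finiteness) (by
    have := integral_nonneg (μ := μ) (f := u) fun x => hu x
    have := integral_nonneg (μ := ν) (f := v) fun x => hv x
    positivity), ENNReal.toReal_add (by finiteness) (by finiteness)]
  simp only [Measure.real] at h1 h2
  linarith

/-- A compact space over `X × Z` that has no cover of small mass carries a nonzero finite measure
whose marginals are dominated by `μ` and `ν`. -/
theorem exists_measure_of_coverNumber_ne_zero [CompactSpace K] [T2Space K] [MeasurableSpace K]
    [BorelSpace K]
    [TopologicalSpace.PseudoMetrizableSpace X] [TopologicalSpace.PseudoMetrizableSpace Z]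
    [BorelSpace X] [BorelSpace Z] [IsFiniteMeasure μ] [IsFiniteMeasure ν]
    (hg₁ : Continuous g₁) (hg₂ : Continuous g₂) (h : coverNumber μ ν g₁ g₂ univ ≠ 0) :
    ∃ γ : Measure K, IsFiniteMeasure γ ∧ γ ≠ 0 ∧ γ.map g₁ ≤ μ ∧ γ.map g₂ ≤ ν := by
  have hpos : 0 < dominatingCost μ ν g₁ g₂ 1 := by
    have := (pos_iff_ne_zero.2 h).trans_le coverNumber_le_dominatingCost
    simpa using this
  have hK : Nonempty K := by
    by_contra hK
    rw [not_nonempty_iff] at hK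
    refine h (le_zero_iff.1 ?_)
    refine (coverNumber_le MeasurableSet.empty MeasurableSet.empty fun k => hK.elim k).trans ?_
    simp
  -- Hahn–Banach extends t · 1 ↦ t · p(1) below the sublinear p = `dominatingCost`. Domination makes
  -- Λ positive because p(-f) ≤ 0 for f ≥ 0, and it bounds the marginals because functions u ∘ g₁
  -- and v ∘ g₂ dominate themselves; p(1) > 0 makes Λ nonzero.
  obtain ⟨Λ, hΛ1, hΛ⟩ := exists_extension_of_le_sublinear
    (LinearPMap.mkSpanSingleton (1 : C(K, ℝ)) (dominatingCost μ ν g₁ g₂ 1) one_ne_zero)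
    (dominatingCost μ ν g₁ g₂) (fun c hc x => dominatingCost_smul hc x) dominatingCost_add_le
    (by
      rintro ⟨x, hx⟩
      obtain ⟨t, rfl⟩ := Submodule.mem_span_singleton.1 hx
      have := LinearPMap.mkSpanSingleton'_apply (σ := RingHom.id ℝ) (1 : C(K, ℝ))
        (dominatingCost μ ν g₁ g₂ 1) (fun c hc => by
          have hc0 : c = 0 := by simpa using hc
          simp [hc0]) t hx
      refine this.trans_le ?_
      rw [RingHom.id_apply, smul_eq_mul]
      rcases le_or_gt t 0 with ht | ht
      · exact (mul_nonpos_of_nonpos_of_nonneg ht hpos.le).trans (dominatingCost_nonneg _)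
      · exact (dominatingCost_smul ht _).ge)
  have hΛone : Λ 1 = dominatingCost μ ν g₁ g₂ 1 := by
    have := hΛ1 ⟨1, Submodule.mem_span_singleton_self _⟩
    exact this.trans (LinearPMap.mkSpanSingleton'_apply_self _ _ _ _)
  have hΛnonneg : ∀ f : C(K, ℝ), 0 ≤ f → 0 ≤ Λ f := by
    intro f hf
    have h1 : dominatingCost μ ν g₁ g₂ (-f) ≤ 0 :=
      dominatingCost_le ⟨0, 0, le_rfl, le_rfl, fun k => by simpa using hf k, by simp⟩
    have h2 := (hΛ (-f)).trans h1
    rw [map_neg] at h2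
    linarith
  let Φ : CompactlySupportedContinuousMap K ℝ →ₚ[ℝ] ℝ :=
    { toFun := fun f => Λ f.toContinuousMap
      map_add' := fun f f' => Λ.map_add _ _
      map_smul' := fun c f => Λ.map_smul c _
      monotone' := fun f f' hff' => by
        have := hΛnonneg (f'.toContinuousMap - f.toContinuousMap) (sub_nonneg.2 hff')
        rw [map_sub] at this
        linarith }
  let γ := RealRMK.rieszMeasure Φ
  have hγ : ∀ f : C(K, ℝ), ∫ k, f k ∂γ = Λ f := fun f =>
    RealRMK.integral_rieszMeasure Φ ⟨f, HasCompactSupport.of_compactSpace _⟩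
  refine ⟨γ, inferInstance, fun h0 => ?_, ?_, ?_⟩
  · have := hγ 1
    rw [h0, hΛone] at this
    simp only [integral_zero_measure] at this
    exact hpos.ne this
  · refine measure_le_of_forall_integral_le fun u hu => ?_
    rw [integral_map hg₁.aemeasurable u.continuous.aestronglyMeasurable]
    refine (hγ ⟨fun k => u (g₁ k), by fun_prop⟩).trans_le ((hΛ _).trans ?_)
    exact dominatingCost_le ⟨u, 0, hu, le_rfl, fun k => by simp, by simp⟩
  · refine measure_le_of_forall_integral_le fun v hv => ?_
    rw [integral_map hg₂.aemeasurable v.continuous.aestronglyMeasurable]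
    refine (hγ ⟨fun k => v (g₂ k), by fun_prop⟩).trans_le ((hΛ _).trans ?_)
    exact dominatingCost_le ⟨0, v, le_rfl, hv, fun k => by simp, by simp⟩

end CompactDuality

/-- A standard Borel space over `X × Z` either is covered by null sets of `X` and `Z`, or carries
a nonzero finite measure whose marginals are dominated by `μ` and `ν`. -/
theorem exists_null_cover_or_exists_measure {W X Z : Type*} [MeasurableSpace W]
    [StandardBorelSpace W] [TopologicalSpace X] [PolishSpace X] [MeasurableSpace X] [BorelSpace X]
    [TopologicalSpace Z] [PolishSpace Z] [MeasurableSpace Z] [BorelSpace Z] (μ : Measure X)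
    (ν : Measure Z) [IsFiniteMeasure μ] [IsFiniteMeasure ν] {g₁ : W → X} {g₂ : W → Z}
    (hg₁ : Measurable g₁) (hg₂ : Measurable g₂) :
    (∃ A B, MeasurableSet A ∧ MeasurableSet B ∧ (∀ w, g₁ w ∈ A ∨ g₂ w ∈ B) ∧ μ A = 0 ∧ ν B = 0) ∨
    ∃ γ : Measure W, IsFiniteMeasure γ ∧ γ ≠ 0 ∧ γ.map g₁ ≤ μ ∧ γ.map g₂ ≤ ν := by
  by_cases h0 : coverNumber μ ν g₁ g₂ univ = 0
  · obtain ⟨A, B, hA, hB, hcov, hA0, hB0⟩ := exists_null_cover h0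
    exact Or.inl ⟨A, B, hA, hB, fun w => hcov (mem_univ w), hA0, hB0⟩
  right
  have hW : Nonempty W := by
    by_contra hW
    rw [not_nonempty_iff] at hW
    refine h0 (le_zero_iff.1 ?_)
    refine (coverNumber_le MeasurableSet.empty MeasurableSet.empty fun k => hW.elim k).trans ?_
    simp
  let := TopologicalSpace.upgradeIsCompletelyMetrizable X
  let := TopologicalSpace.upgradeIsCompletelyMetrizable Z
  let _ := upgradeStandardBorel W
  obtain ⟨φ, hφ, hφsurj, h1, h2⟩ : ∃ φ : (ℕ → ℕ) → W, Measurable φ ∧ Function.Surjective φ ∧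
      Continuous (g₁ ∘ φ) ∧ Continuous (g₂ ∘ φ) := by
    -- A finer Polish topology on W makes both maps continuous, and W is then a continuous image of
    -- Baire space. The cover number can be computed upstairs because φ is surjective.
    obtain ⟨t, ht, hcont, hpol⟩ := (hg₁.prodMk hg₂).exists_continuous
    obtain ⟨φ, hφ, hsurj⟩ := @PolishSpace.exists_nat_nat_continuous_surjective W t hpol hW
    have hc := @Continuous.comp _ _ _ _ t _ _ _ hcont hφ
    refine ⟨φ, ?_, hsurj, continuous_fst.comp hc, continuous_snd.comp hc⟩
    exact @Continuous.measurable _ _ _ _ _ (_) _ _ _ (continuous_le_rng ht hφ)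
  have hpos : coverNumber μ ν (g₁ ∘ φ) (g₂ ∘ φ) univ ≠ 0 := by
    intro h
    obtain ⟨A, B, hA, hB, hcov, hA0, hB0⟩ := exists_null_cover h
    refine h0 (le_zero_iff.1 ((coverNumber_le hA hB fun w _ => ?_).trans_eq (by
      rw [hA0, hB0, add_zero])))
    obtain ⟨x, rfl⟩ := hφsurj w
    exact hcov (mem_univ x)
  obtain ⟨L, hL, hLpos⟩ := exists_isCompact_coverNumber_pos h1 h2 hpos
  have : CompactSpace L := isCompact_iff_compactSpace.1 hL
  have hLpos' : coverNumber μ ν (fun x : L => g₁ (φ x)) (fun x : L => g₂ (φ x)) univ ≠ 0 := by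
    intro h
    obtain ⟨A, B, hA, hB, hcov, hA0, hB0⟩ := exists_null_cover h
    refine hLpos (le_zero_iff.1 ((coverNumber_le hA hB fun w hw => ?_).trans_eq (by
      rw [hA0, hB0, add_zero])))
    exact hcov (mem_univ (⟨w, hw⟩ : L))
  obtain ⟨γ, hγ, hγ0, hγ1, hγ2⟩ := exists_measure_of_coverNumber_ne_zero
    (h1.comp continuous_subtype_val) (h2.comp continuous_subtype_val) hLpos'
  have hm : Measurable fun x : L => φ x := hφ.comp measurable_subtype_coe
  refine ⟨γ.map fun x : L => φ x, inferInstance, ?_, ?_, ?_⟩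
  · rwa [Ne, Measure.map_eq_zero_iff hm.aemeasurable]
  · rwa [Measure.map_map hg₁ hm]
  · rwa [Measure.map_map hg₂ hm]

/-! ### Extended integrals -/

section ExtIntegral

variable {α : Type*} [MeasurableSpace α] {μ : Measure α}

theorem extIntegral_mono_ae {f g : α → EReal} (h : ∀ᵐ x ∂μ, f x ≤ g x) :
    extIntegral μ f ≤ extIntegral μ g := by
  unfold extIntegral
  have h1 : ∫⁻ x, (f x).toENNReal ∂μ ≤ ∫⁻ x, (g x).toENNReal ∂μ :=
    lintegral_mono_ae (h.mono fun x hx => EReal.toENNReal_le_toENNReal hx)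
  have h2 : ∫⁻ x, (-g x).toENNReal ∂μ ≤ ∫⁻ x, (-f x).toENNReal ∂μ :=
    lintegral_mono_ae (h.mono fun x hx => EReal.toENNReal_le_toENNReal (EReal.neg_le_neg_iff.2 hx))
  split_ifs with hf hg hg
  · exact le_rfl
  · exact absurd (top_le_iff.1 (hf ▸ h1)) hg
  · exact le_top
  · exact EReal.sub_le_sub (EReal.coe_ennreal_le_coe_ennreal_iff.2 h1)
      (EReal.coe_ennreal_le_coe_ennreal_iff.2 h2)

theorem extIntegral_congr_ae {f g : α → EReal} (h : ∀ᵐ x ∂μ, f x = g x) :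
    extIntegral μ f = extIntegral μ g :=
  (extIntegral_mono_ae (h.mono fun _ hx => hx.le)).antisymm
    (extIntegral_mono_ae (h.mono fun _ hx => hx.ge))

theorem extIntegral_coe {g : α → ℝ} (hg : Integrable g μ) :
    extIntegral μ (fun x => (g x : EReal)) = ((∫ x, g x ∂μ : ℝ) : EReal) := by
  have e1 : ∀ x, ((g x : ℝ) : EReal).toENNReal = ENNReal.ofReal (g x) := fun x => by
    rw [EReal.toENNReal_of_ne_top (EReal.coe_ne_top _), EReal.toReal_coe]
  have e2 : ∀ x, (-((g x : ℝ) : EReal)).toENNReal = ENNReal.ofReal (-g x) := fun x => by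
    rw [← EReal.coe_neg, EReal.toENNReal_of_ne_top (EReal.coe_ne_top _), EReal.toReal_coe]
  have h1 : ∫⁻ x, ENNReal.ofReal (g x) ∂μ ≠ ⊤ := hg.lintegral_lt_top.ne
  have h2 : ∫⁻ x, ENNReal.ofReal (-g x) ∂μ ≠ ⊤ := hg.neg.lintegral_lt_top.ne
  unfold extIntegral
  simp only [e1, e2]
  rw [if_neg h1, integral_eq_lintegral_pos_part_sub_lintegral_neg_part hg, EReal.coe_sub,
    EReal.coe_ennreal_toReal h1, EReal.coe_ennreal_toReal h2]

/-- With ∞ - ∞ read as ∞, a value other than ⊤ rules out an infinite positive part; given that, a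
value other than ⊥ rules out an infinite negative part. -/
theorem extIntegral_eq_coe_of_finite {f : α → EReal} (hf : AEMeasurable f μ)
    (htop : extIntegral μ f ≠ ⊤) (hbot : extIntegral μ f ≠ ⊥) :
    (∀ᵐ x ∂μ, f x ≠ ⊤) ∧ (∀ᵐ x ∂μ, f x ≠ ⊥) ∧ Integrable (fun x => (f x).toReal) μ ∧
      extIntegral μ f = ((∫ x, (f x).toReal ∂μ : ℝ) : EReal) := by
  have h1 : ∫⁻ x, (f x).toENNReal ∂μ ≠ ⊤ := fun h => htop (if_pos h)
  have h2 : ∫⁻ x, (-f x).toENNReal ∂μ ≠ ⊤ := by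
    intro h
    refine hbot ((if_neg h1).trans ?_)
    rw [h, EReal.coe_ennreal_top]
    exact EReal.sub_top _
  have hm1 : AEMeasurable (fun x => (f x).toENNReal) μ := hf.ereal_toENNReal
  have hm2 : AEMeasurable (fun x => (-f x).toENNReal) μ := hf.neg.ereal_toENNReal
  have ht : ∀ᵐ x ∂μ, f x ≠ ⊤ := (ae_lt_top' hm1 h1).mono fun x hx => by
    simpa using hx.ne
  have hb : ∀ᵐ x ∂μ, f x ≠ ⊥ := (ae_lt_top' hm2 h2).mono fun x hx => by
    simpa using hx.ne
  have hint : Integrable (fun x => (f x).toReal) μ := by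
    refine ⟨hf.ereal_toReal.aestronglyMeasurable, ?_⟩
    refine lt_of_le_of_lt (lintegral_mono_ae (g := fun x => (f x).toENNReal + (-f x).toENNReal)
      ?_) (?_ : _ < ⊤)
    · filter_upwards [ht, hb] with x hx hx'
      lift f x to ℝ using ⟨hx, hx'⟩ with r
      rw [← EReal.coe_neg, EReal.toENNReal_of_ne_top (EReal.coe_ne_top _),
        EReal.toENNReal_of_ne_top (EReal.coe_ne_top _), EReal.toReal_coe, EReal.toReal_coe,
        Real.enorm_eq_ofReal_abs]
      rcases le_total 0 r with h | h
      · rw [abs_of_nonneg h]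
        exact le_self_add
      · rw [abs_of_nonpos h]
        exact le_add_self
    · rw [lintegral_add_left' hm1]
      exact ENNReal.add_lt_top.2 ⟨h1.lt_top, h2.lt_top⟩
  refine ⟨ht, hb, hint, ?_⟩
  rw [← extIntegral_coe hint]
  refine extIntegral_congr_ae ?_
  filter_upwards [ht, hb] with x hx hx'
  rw [EReal.coe_toReal hx hx']

end ExtIntegral

/-! ### Competitors built from randomized kernels -/

section Competitor

variable {X Y : Type*} [MeasurableSpace X] [TopologicalSpace Y] [PolishSpace Y]
  [MeasurableSpace Y] [BorelSpace Y]

theorem measurable_kernelLaw {X Y : Type*} [MeasurableSpace X] [MeasurableSpace Y]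
    (κ : Kernel X Y) [IsMarkovKernel κ] : Measurable (kernelLaw κ) :=
  measurable_law_iff.2 κ.measurable

/-- The identity of the space of laws, as a kernel. -/
noncomputable def lawKernel (Y : Type*) [MeasurableSpace Y] : Kernel (ProbabilityMeasure Y) Y :=
  ⟨fun m => m, measurable_subtype_coe⟩

instance (Y : Type*) [MeasurableSpace Y] : IsMarkovKernel (lawKernel Y) :=
  ⟨fun m => inferInstanceAs (IsProbabilityMeasure (m : Measure Y))⟩

variable {C : X → ProbabilityMeasure Y → EReal} {μ : Measure X} [IsProbabilityMeasure μ]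
  {κ : Kernel X Y} [IsMarkovKernel κ]

/-- If `κ` is optimal among the kernels that transport `μ` to the same measure, it is also optimal
among the random kernels: the measures on `X × 𝒫(Y)` with first marginal `μ`. -/
theorem integral_le_of_randomized {J : ℝ} (hbot : ∀ x m, C x m ≠ ⊥)
    (hconv : ∀ᵐ x ∂μ, ConvexOnLaws (C x) ∧ LowerSemicontinuous (C x))
    (hopt : ∀ (η : Kernel X Y) [IsMarkovKernel η], η ∘ₘ μ = κ ∘ₘ μ →
      (J : EReal) ≤ extIntegral μ fun x => C x (kernelLaw η x))
    {θ : Measure (X × ProbabilityMeasure Y)} [IsFiniteMeasure θ] (hfst : θ.fst = μ)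
    (htop : ∀ᵐ z ∂θ, C z.1 z.2 ≠ ⊤) (hint : Integrable (fun z => (C z.1 z.2).toReal) θ)
    (hsnd : ∀ s, MeasurableSet s → ∫⁻ z, (z.2 : Measure Y) s ∂θ = (κ ∘ₘ μ) s) :
    J ≤ ∫ z, (C z.1 z.2).toReal ∂θ := by
  have hY : Nonempty (ProbabilityMeasure Y) := by
    have : Nonempty X := nonempty_of_isProbabilityMeasure μ
    exact ⟨kernelLaw κ this.some⟩
  let Θ := θ.condKernel
  have hθ : θ = μ ⊗ₘ Θ := by rw [← hfst]; exact (θ.disintegrate θ.condKernel).symm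
  -- At each x this is the barycenter of the random law Θ x. Averaging preserves the second
  -- marginal, and Jensen's inequality shows that it does not raise the cost.
  let η : Kernel X Y := lawKernel Y ∘ₖ Θ
  have hη : ∀ x s, MeasurableSet s → η x s = ∫⁻ m, (m : Measure Y) s ∂(Θ x) := fun x s hs =>
    Kernel.comp_apply' _ _ _ hs
  have hmarg : η ∘ₘ μ = κ ∘ₘ μ := by
    ext s hs
    have hm : Measurable fun z : X × ProbabilityMeasure Y => (z.2 : Measure Y) s :=
      (measurable_law_apply hs).comp measurable_snd
    rw [← hsnd s hs, hθ, Measure.lintegral_compProd hm,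
      Measure.bind_apply hs η.measurable.aemeasurable]
    exact lintegral_congr fun x => hη x s hs
  rw [hθ] at htop hint ⊢
  have hae := Measure.ae_ae_of_ae_compProd htop
  have hii := (Measure.integrable_compProd_iff hint.aestronglyMeasurable).1 hint
  have hi : Integrable (fun x => ∫ m, (C x m).toReal ∂(Θ x)) μ :=
    Integrable.integral_compProd (κ := Kernel.const Unit μ) (η := Kernel.prodMkLeft Unit Θ)
      (a := ()) hint
  rw [← EReal.coe_le_coe_iff, Measure.integral_compProd hint, ← extIntegral_coe hi]
  refine (hopt η hmarg).trans (extIntegral_mono_ae ?_)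
  filter_upwards [hconv, hae, hii.1] with x hx hx' hx''
  exact hx.1.map_barycenter_le hx.2 (hbot x) hx' hx'' fun s hs => hη x s hs

/-- No improvement of the conditional laws along a measure on pairs of points is possible. -/
theorem measure_eq_zero_of_improving {W : Type*} [MeasurableSpace W] (hbot : ∀ x m, C x m ≠ ⊥)
    (hC : Measurable fun z : X × ProbabilityMeasure Y => C z.1 z.2)
    (hconv : ∀ᵐ x ∂μ, ConvexOnLaws (C x) ∧ LowerSemicontinuous (C x))
    (htop : ∀ᵐ x ∂μ, C x (kernelLaw κ x) ≠ ⊤)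
    (hint : Integrable (fun x => (C x (kernelLaw κ x)).toReal) μ)
    (hopt : ∀ (η : Kernel X Y) [IsMarkovKernel η], η ∘ₘ μ = κ ∘ₘ μ →
      ((∫ x, (C x (kernelLaw κ x)).toReal ∂μ : ℝ) : EReal) ≤
        extIntegral μ fun x => C x (kernelLaw η x))
    {γ : Measure W} [IsFiniteMeasure γ] {g₁ g₂ : W → X} {m₁ m₂ : W → ProbabilityMeasure Y}
    (hg₁ : Measurable g₁) (hg₂ : Measurable g₂) (hm₁ : Measurable m₁) (hm₂ : Measurable m₂)
    (hγ : γ.map g₁ + γ.map g₂ ≤ μ)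
    (hsum : ∀ w, (m₁ w : Measure Y) + (m₂ w : Measure Y) = κ (g₁ w) + κ (g₂ w))
    (htop₁ : ∀ w, C (g₁ w) (m₁ w) ≠ ⊤) (htop₂ : ∀ w, C (g₂ w) (m₂ w) ≠ ⊤)
    (hint₁ : Integrable (fun w => (C (g₁ w) (m₁ w)).toReal) γ)
    (hint₂ : Integrable (fun w => (C (g₂ w) (m₂ w)).toReal) γ)
    (hlt : ∀ w, (C (g₁ w) (m₁ w)).toReal + (C (g₂ w) (m₂ w)).toReal <
      (C (g₁ w) (kernelLaw κ (g₁ w))).toReal + (C (g₂ w) (kernelLaw κ (g₂ w))).toReal) :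
    γ = 0 := by
  set c : X → ℝ := fun x => (C x (kernelLaw κ x)).toReal with hc
  set f : X × ProbabilityMeasure Y → ℝ := fun z => (C z.1 z.2).toReal with hf
  have hfm : Measurable f := hC.ereal_toReal
  let ρ := γ.map g₁ + γ.map g₂
  let τ := μ - ρ
  have hτρ : τ + ρ = μ := Measure.sub_add_cancel_of_le hγ
  have hτle : τ ≤ μ := Measure.sub_le
  have hk : Measurable fun x => (x, kernelLaw κ x) := measurable_id.prodMk (measurable_kernelLaw κ)
  have hk₁ := hg₁.prodMk hm₁
  have hk₂ := hg₂.prodMk hm₂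
  -- The remainder τ keeps the law κ x, while the mass ρ taken from μ is sent to the improved laws
  -- m₁ and m₂.
  let θ : Measure (X × ProbabilityMeasure Y) :=
    τ.map (fun x => (x, kernelLaw κ x)) +
      (γ.map (fun w => (g₁ w, m₁ w)) + γ.map (fun w => (g₂ w, m₂ w)))
  have hτfin : IsFiniteMeasure τ := isFiniteMeasure_of_le μ hτle
  have hcτ : Integrable c τ := hint.mono_measure hτle
  have hcρ : Integrable c ρ := hint.mono_measure hγ
  have hcρ' := integrable_add_measure.1 hcρ
  have hcm : Measurable c := hfm.comp hk
  have hc₁ : Integrable (fun w => c (g₁ w)) γ := hcρ'.1.comp_measurable hg₁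
  have hc₂ : Integrable (fun w => c (g₂ w)) γ := hcρ'.2.comp_measurable hg₂
  have i0 : Integrable f (τ.map (fun x => (x, kernelLaw κ x))) :=
    (integrable_map_measure hfm.aestronglyMeasurable hk.aemeasurable).2 hcτ
  have i1 : Integrable f (γ.map (fun w => (g₁ w, m₁ w))) :=
    (integrable_map_measure hfm.aestronglyMeasurable hk₁.aemeasurable).2 hint₁
  have i2 : Integrable f (γ.map (fun w => (g₂ w, m₂ w))) :=
    (integrable_map_measure hfm.aestronglyMeasurable hk₂.aemeasurable).2 hint₂
  have hset : MeasurableSet {z : X × ProbabilityMeasure Y | C z.1 z.2 ≠ ⊤} :=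
    hC (measurableSet_singleton ⊤).compl
  have key := integral_le_of_randomized (θ := θ) hbot hconv hopt ?_ ?_ ?_ ?_
  · rw [integral_add_measure i0 (i1.add_measure i2), integral_add_measure i1 i2,
      integral_map hk.aemeasurable hfm.aestronglyMeasurable,
      integral_map hk₁.aemeasurable hfm.aestronglyMeasurable,
      integral_map hk₂.aemeasurable hfm.aestronglyMeasurable] at key
    have hμ : ∫ x, c x ∂μ = ∫ x, c x ∂τ + (∫ w, c (g₁ w) ∂γ + ∫ w, c (g₂ w) ∂γ) := by
      rw [← hτρ, integral_add_measure hcτ hcρ, integral_add_measure hcρ'.1 hcρ'.2,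
        integral_map hg₁.aemeasurable hcm.aestronglyMeasurable,
        integral_map hg₂.aemeasurable hcm.aestronglyMeasurable]
    -- The gain is positive everywhere, whereas optimality makes its γ-integral nonpositive; only γ
    -- = 0 allows both.
    let D : W → ℝ := fun w => (c (g₁ w) + c (g₂ w)) - (f (g₁ w, m₁ w) + f (g₂ w, m₂ w))
    have hD : ∀ w, 0 < D w := fun w => sub_pos.2 (hlt w)
    have hDi : Integrable D γ := (hc₁.add hc₂).sub (hint₁.add hint₂)
    have hDle : ∫ w, D w ∂γ ≤ 0 := by
      have e : ∫ w, D w ∂γ = (∫ w, c (g₁ w) ∂γ + ∫ w, c (g₂ w) ∂γ) -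
          (∫ w, f (g₁ w, m₁ w) ∂γ + ∫ w, f (g₂ w, m₂ w) ∂γ) := by
        rw [← integral_add hc₁ hc₂, ← integral_add hint₁ hint₂]
        exact integral_sub (hc₁.add hc₂) (hint₁.add hint₂)
      rw [e]
      have : (∫ x, c x ∂τ) = ∫ x, f (x, kernelLaw κ x) ∂τ := rfl
      linarith
    have hD0 := (integral_eq_zero_iff_of_nonneg (fun w => (hD w).le) hDi).1
      (hDle.antisymm (integral_nonneg fun w => (hD w).le))
    have : ∀ᵐ w ∂γ, False := hD0.mono fun w hw => (hD w).ne' hw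
    simpa using this
  · ext s hs
    rw [Measure.fst_apply hs]
    simp only [θ, Measure.add_apply]
    rw [Measure.map_apply hk (measurable_fst hs), Measure.map_apply hk₁ (measurable_fst hs),
      Measure.map_apply hk₂ (measurable_fst hs)]
    conv_rhs => rw [← hτρ]
    simp only [ρ, Measure.add_apply]
    rw [Measure.map_apply hg₁ hs, Measure.map_apply hg₂ hs]
    rfl
  · refine ae_add_measure_iff.2 ⟨?_, ae_add_measure_iff.2 ⟨?_, ?_⟩⟩
    · rw [ae_map_iff hk.aemeasurable hset]
      exact hτle.absolutelyContinuous.ae_le htop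
    · rw [ae_map_iff hk₁.aemeasurable hset]
      exact Eventually.of_forall htop₁
    · rw [ae_map_iff hk₂.aemeasurable hset]
      exact Eventually.of_forall htop₂
  · exact i0.add_measure (i1.add_measure i2)
  · intro s hs
    have hsm : Measurable fun z : X × ProbabilityMeasure Y => (z.2 : Measure Y) s :=
      (measurable_law_apply hs).comp measurable_snd
    have hκs : Measurable fun x => κ x s := κ.measurable_coe hs
    simp only [θ, lintegral_add_measure]
    rw [lintegral_map hsm hk, lintegral_map hsm hk₁, lintegral_map hsm hk₂,
      Measure.bind_apply hs κ.measurable.aemeasurable, ← hτρ, lintegral_add_measure,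
      lintegral_add_measure, lintegral_map hκs hg₁, lintegral_map hκs hg₂]
    congr 1
    have hms : Measurable fun w => (m₁ w : Measure Y) s := (measurable_law_apply hs).comp hm₁
    have hgs : Measurable fun w => κ (g₁ w) s := hκs.comp hg₁
    rw [← lintegral_add_left hms, ← lintegral_add_left hgs]
    exact lintegral_congr fun w => by
      simpa using congrArg (fun m : Measure Y => m s) (hsum w)

end Competitor

/-! ### Two-point optimality for the weak transport problem -/

section SwapMonotone

/-- The mean of two laws. -/
noncomputable def midLaw {Y : Type*} [MeasurableSpace Y]
    (p : ProbabilityMeasure Y × ProbabilityMeasure Y) : ProbabilityMeasure Y :=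
  ⟨(2⁻¹ : ℝ≥0∞) • ((p.1 : Measure Y) + (p.2 : Measure Y)), ⟨by
    simp only [Measure.smul_apply, Measure.add_apply, measure_univ, smul_eq_mul]
    rw [one_add_one_eq_two, ENNReal.inv_mul_cancel (by simp) (by simp)]⟩⟩

theorem midLaw_eq_iff {Y : Type*} [MeasurableSpace Y]
    {p q : ProbabilityMeasure Y × ProbabilityMeasure Y} :
    midLaw p = midLaw q ↔
      (p.1 : Measure Y) + (p.2 : Measure Y) = (q.1 : Measure Y) + (q.2 : Measure Y) := by
  constructor
  · intro h
    have h' : (2⁻¹ : ℝ≥0∞) • ((p.1 : Measure Y) + (p.2 : Measure Y)) =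
        (2⁻¹ : ℝ≥0∞) • ((q.1 : Measure Y) + (q.2 : Measure Y)) := congrArg Subtype.val h
    have := congrArg (fun m : Measure Y => (2 : ℝ≥0∞) • m) h'
    simpa only [smul_smul, ENNReal.mul_inv_cancel two_ne_zero ENNReal.ofNat_ne_top, one_smul]
      using this
  · intro h
    apply Subtype.ext
    simp only [midLaw, h]

theorem measurable_midLaw {Y : Type*} [MeasurableSpace Y] :
    Measurable (midLaw : ProbabilityMeasure Y × ProbabilityMeasure Y → ProbabilityMeasure Y) := by
  refine measurable_law_iff.2 (Measure.measurable_of_measurable_coe _ fun s hs => ?_)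
  have h1 : Measurable fun p : ProbabilityMeasure Y × ProbabilityMeasure Y =>
      (p.1 : Measure Y) s := (measurable_law_apply hs).comp measurable_fst
  have h2 : Measurable fun p : ProbabilityMeasure Y × ProbabilityMeasure Y =>
      (p.2 : Measure Y) s := (measurable_law_apply hs).comp measurable_snd
  exact (h1.add h2).const_mul (2⁻¹ : ℝ≥0∞)

theorem exists_abs_le_of_finite {a : EReal} (h : a ≠ ⊤) (h' : a ≠ ⊥) :
    ∃ n : ℕ, -(n : ℝ) ≤ a ∧ a ≤ (n : ℝ) := by
  lift a to ℝ using ⟨h, h'⟩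
  obtain ⟨n, hn⟩ := exists_nat_ge |a|
  refine ⟨n, ?_, by exact_mod_cast (le_abs_self a).trans hn⟩
  rw [← EReal.coe_neg]
  exact_mod_cast (neg_le_of_abs_le hn)

variable {X Y : Type*} [MeasurableSpace X]
  [TopologicalSpace Y] [PolishSpace Y] [MeasurableSpace Y] [BorelSpace Y]
  {C : X → ProbabilityMeasure Y → EReal} {μ : Measure X} {κ : Kernel X Y} [IsMarkovKernel κ]

/-- The pairs of points with a redistribution of their conditional laws that lowers the cost,
all costs involved lying in `[-N, N]`. -/
def improvingPairs (C : X → ProbabilityMeasure Y → EReal) (κ : Kernel X Y) [IsMarkovKernel κ]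
    (N : ℕ) : Set ((X × X) × ProbabilityMeasure Y × ProbabilityMeasure Y) :=
  {w | midLaw w.2 = midLaw (kernelLaw κ w.1.1, kernelLaw κ w.1.2) ∧
    C w.1.1 w.2.1 ∈ Icc (((-(N : ℝ) : ℝ)) : EReal) (N : ℝ) ∧
    C w.1.2 w.2.2 ∈ Icc (((-(N : ℝ) : ℝ)) : EReal) (N : ℝ) ∧
    C w.1.1 w.2.1 + C w.1.2 w.2.2 < C w.1.1 (kernelLaw κ w.1.1) + C w.1.2 (kernelLaw κ w.1.2) ∧
    C w.1.1 (kernelLaw κ w.1.1) ≠ ⊤ ∧ C w.1.2 (kernelLaw κ w.1.2) ≠ ⊤}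

theorem measurableSet_improvingPairs
    (hC : Measurable fun z : X × ProbabilityMeasure Y => C z.1 z.2) (N : ℕ) :
    MeasurableSet (improvingPairs C κ N) := by
  have hκ := measurable_kernelLaw κ
  have h11 : Measurable fun w : (X × X) × ProbabilityMeasure Y × ProbabilityMeasure Y => w.1.1 := by
    fun_prop
  have h12 : Measurable fun w : (X × X) × ProbabilityMeasure Y × ProbabilityMeasure Y => w.1.2 := by
    fun_prop
  have c1 : Measurable fun w : (X × X) × ProbabilityMeasure Y × ProbabilityMeasure Y =>
      C w.1.1 w.2.1 := hC.comp (h11.prodMk (by fun_prop))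
  have c2 : Measurable fun w : (X × X) × ProbabilityMeasure Y × ProbabilityMeasure Y =>
      C w.1.2 w.2.2 := hC.comp (h12.prodMk (by fun_prop))
  have k1 : Measurable fun w : (X × X) × ProbabilityMeasure Y × ProbabilityMeasure Y =>
      C w.1.1 (kernelLaw κ w.1.1) := hC.comp (h11.prodMk (hκ.comp h11))
  have k2 : Measurable fun w : (X × X) × ProbabilityMeasure Y × ProbabilityMeasure Y =>
      C w.1.2 (kernelLaw κ w.1.2) := hC.comp (h12.prodMk (hκ.comp h12))
  -- `midLaw` turns equality of sums of measures into equality of points in the standard Borel space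
  -- of laws, where equality of measurable maps is a measurable condition.
  refine (measurableSet_eq_fun (measurable_midLaw.comp measurable_snd)
    (measurable_midLaw.comp ((hκ.comp h11).prodMk (hκ.comp h12)))).inter ?_
  refine (c1 measurableSet_Icc).inter ((c2 measurableSet_Icc).inter ?_)
  refine (measurableSet_lt (c1.add c2) (k1.add k2)).inter ?_
  exact (k1 (measurableSet_singleton ⊤).compl).inter (k2 (measurableSet_singleton ⊤).compl)

variable [TopologicalSpace X] [PolishSpace X] [BorelSpace X]

theorem toReal_add_lt {a b c d : EReal} (ha : a ≠ ⊤) (ha' : a ≠ ⊥) (hb : b ≠ ⊤) (hb' : b ≠ ⊥)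
    (hc : c ≠ ⊤) (hc' : c ≠ ⊥) (hd : d ≠ ⊤) (hd' : d ≠ ⊥) (h : a + b < c + d) :
    a.toReal + b.toReal < c.toReal + d.toReal := by
  lift a to ℝ using ⟨ha, ha'⟩
  lift b to ℝ using ⟨hb, hb'⟩
  lift c to ℝ using ⟨hc, hc'⟩
  lift d to ℝ using ⟨hd, hd'⟩
  exact_mod_cast h

theorem abs_toReal_le_of_mem_Icc {a : EReal} {N : ℝ} (h : a ∈ Icc ((-N : ℝ) : EReal) N) :
    |a.toReal| ≤ N := by
  have h1 : a ≠ ⊤ := fun h' => absurd (h' ▸ h.2) (not_le.2 (EReal.coe_lt_top N))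
  have h2 : a ≠ ⊥ := fun h' => absurd (h' ▸ h.1) (not_le.2 (EReal.bot_lt_coe _))
  lift a to ℝ using ⟨h1, h2⟩
  rw [EReal.toReal_coe, abs_le]
  exact ⟨by exact_mod_cast h.1, by exact_mod_cast h.2⟩

/-- **Two-point optimality.** If the kernel `κ` minimizes the weak transport cost among the kernels
which transport `μ` to the same measure, then on a set of full measure no two points can exchange
mass in a way that lowers the cost. -/
theorem exists_swap_monotone_set [IsProbabilityMeasure μ] (hbot : ∀ x m, C x m ≠ ⊥)
    (hC : Measurable fun z : X × ProbabilityMeasure Y => C z.1 z.2)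
    (hconv : ∀ᵐ x ∂μ, ConvexOnLaws (C x) ∧ LowerSemicontinuous (C x))
    (htop : ∀ᵐ x ∂μ, C x (kernelLaw κ x) ≠ ⊤)
    (hint : Integrable (fun x => (C x (kernelLaw κ x)).toReal) μ)
    (hopt : ∀ (η : Kernel X Y) [IsMarkovKernel η], η ∘ₘ μ = κ ∘ₘ μ →
      ((∫ x, (C x (kernelLaw κ x)).toReal ∂μ : ℝ) : EReal) ≤
        extIntegral μ fun x => C x (kernelLaw η x)) :
    ∃ Γ : Set X, MeasurableSet Γ ∧ μ Γ = 1 ∧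
      ∀ x ∈ Γ, ∀ x' ∈ Γ, ∀ m m' : ProbabilityMeasure Y,
        (m : Measure Y) + (m' : Measure Y) = κ x + κ x' →
        C x (kernelLaw κ x) + C x' (kernelLaw κ x') ≤ C x m + C x' m' := by
  -- Truncating the new costs to [-N, N] makes them integrable for every finite measure. Countably
  -- many N suffice, as a strict improvement on finite costs has finite cost itself.
  have hcover : ∀ N : ℕ, ∃ A : Set X, μ A = 0 ∧ ∀ w ∈ improvingPairs C κ N,
      w.1.1 ∈ A ∨ w.1.2 ∈ A := by
    intro N
    have hms := measurableSet_improvingPairs (κ := κ) hC N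
    have := hms.standardBorel
    have hg₁ : Measurable fun w : improvingPairs C κ N => w.1.1.1 := by fun_prop
    have hg₂ : Measurable fun w : improvingPairs C κ N => w.1.1.2 := by fun_prop
    have hm₁ : Measurable fun w : improvingPairs C κ N => w.1.2.1 := by fun_prop
    have hm₂ : Measurable fun w : improvingPairs C κ N => w.1.2.2 := by fun_prop
    rcases exists_null_cover_or_exists_measure μ μ hg₁ hg₂ with
      ⟨A, B, -, -, hcov, hA, hB⟩ | ⟨γ, hγ, hγ0, hγ1, hγ2⟩
    · exact ⟨A ∪ B, measure_union_null hA hB, fun w hw =>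
        (hcov ⟨w, hw⟩).imp (fun h => Or.inl h) fun h => Or.inr h⟩
    · exfalso
      refine hγ0 ?_
      -- Each marginal of γ is at most μ, while the competitor needs their sum to be at most μ.
      have h0 : (2⁻¹ : ℝ≥0∞) • γ = 0 := by
        have hfin : IsFiniteMeasure ((2⁻¹ : ℝ≥0∞) • γ) := Measure.smul_finite γ (by simp)
        have ht : ∀ {a : EReal}, a ∈ Icc (((-(N : ℝ) : ℝ)) : EReal) (N : ℝ) → a ≠ ⊤ :=
          fun h h' => absurd (h' ▸ h.2) (not_le.2 (EReal.coe_lt_top _))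
        have hc₁ : Measurable fun w : improvingPairs C κ N => (C w.1.1.1 w.1.2.1).toReal :=
          (hC.comp (hg₁.prodMk hm₁)).ereal_toReal
        have hc₂ : Measurable fun w : improvingPairs C κ N => (C w.1.1.2 w.1.2.2).toReal :=
          (hC.comp (hg₂.prodMk hm₂)).ereal_toReal
        refine measure_eq_zero_of_improving hbot hC hconv htop hint hopt hg₁ hg₂ hm₁ hm₂ ?_
          (fun w => midLaw_eq_iff.1 w.2.1) (fun w => ht w.2.2.1) (fun w => ht w.2.2.2.1)
          (Integrable.of_bound hc₁.aestronglyMeasurable N (Eventually.of_forall fun w =>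
            abs_toReal_le_of_mem_Icc w.2.2.1))
          (Integrable.of_bound hc₂.aestronglyMeasurable N (Eventually.of_forall fun w =>
            abs_toReal_le_of_mem_Icc w.2.2.2.1))
          (fun w => toReal_add_lt (ht w.2.2.1) (hbot _ _) (ht w.2.2.2.1) (hbot _ _)
            w.2.2.2.2.2.1 (hbot _ _) w.2.2.2.2.2.2 (hbot _ _) w.2.2.2.2.1)
        rw [Measure.map_smul, Measure.map_smul, ← smul_add]
        refine Measure.le_iff.2 fun s hs => ?_
        rw [Measure.smul_apply, Measure.add_apply, smul_eq_mul]
        calc 2⁻¹ * (γ.map _ s + γ.map _ s) ≤ 2⁻¹ * (μ s + μ s) := by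
              gcongr
          _ = μ s := by
              rw [← two_mul, ← mul_assoc, ENNReal.inv_mul_cancel (by simp) (by simp), one_mul]
      simpa using h0
  choose A hA hAcov using hcover
  have hgood : ∀ᵐ x ∂μ, C x (kernelLaw κ x) ≠ ⊤ ∧ ∀ N, x ∉ A N :=
    htop.and (ae_all_iff.2 fun N => measure_eq_zero_iff_ae_notMem.1 (hA N))
  obtain ⟨T, hT, hTm, hT0⟩ := exists_measurable_superset_of_null (ae_iff.1 hgood)
  refine ⟨Tᶜ, hTm.compl, by rw [prob_compl_eq_one_iff hTm, hT0], ?_⟩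
  have hmem : ∀ x ∈ Tᶜ, C x (kernelLaw κ x) ≠ ⊤ ∧ ∀ N, x ∉ A N := fun x hx => by
    by_contra h
    exact hx (hT h)
  intro x hx x' hx' m m' hmm
  obtain ⟨hxt, hxA⟩ := hmem x hx
  obtain ⟨hxt', hxA'⟩ := hmem x' hx'
  by_contra! hlt
  have hm : C x m ≠ ⊤ := by
    intro h
    rw [h, EReal.top_add_of_ne_bot (hbot _ _)] at hlt
    exact not_top_lt hlt
  have hm' : C x' m' ≠ ⊤ := by
    intro h
    rw [h, EReal.add_top_of_ne_bot (hbot _ _)] at hlt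
    exact not_top_lt hlt
  obtain ⟨n, hn, hn1⟩ := exists_abs_le_of_finite hm (hbot _ _)
  obtain ⟨n', hn', hn1'⟩ := exists_abs_le_of_finite hm' (hbot _ _)
  have hle : ∀ {k l : ℕ} {a : EReal}, k ≤ l → -(k : ℝ) ≤ a → a ≤ (k : ℝ) →
      a ∈ Icc (((-(l : ℝ) : ℝ)) : EReal) (l : ℝ) := by
    intro k l a hkl h1 h2
    have hkl' : (k : ℝ) ≤ l := by exact_mod_cast hkl
    refine ⟨le_trans ?_ h1, h2.trans (EReal.coe_le_coe_iff.2 hkl')⟩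
    rw [EReal.coe_neg]
    exact EReal.neg_le_neg_iff.2 (EReal.coe_le_coe_iff.2 hkl')
  have hw : ((x, x'), (m, m')) ∈ improvingPairs C κ (max n n') :=
    ⟨midLaw_eq_iff.2 hmm, hle (le_max_left _ _) hn hn1, hle (le_max_right _ _) hn' hn1', hlt,
      hxt, hxt'⟩
  exact (hAcov _ _ hw).elim (hxA _) (hxA' _)

theorem kernelLaw_congr {X Y : Type*} [MeasurableSpace X] [MeasurableSpace Y] {κ η : Kernel X Y}
    [IsMarkovKernel κ] [IsMarkovKernel η] {x : X} (h : κ x = η x) :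
    kernelLaw κ x = kernelLaw η x :=
  Subtype.ext h

/-- Disintegrations agree almost everywhere, so the cost does not depend on the version, although
the pointwise conclusions are stated for a chosen κ. -/
theorem weakCost_eq_of_isCondKernel {X Y : Type*} [MeasurableSpace X] [MeasurableSpace Y]
    [StandardBorelSpace Y] [Nonempty Y] {C : X → ProbabilityMeasure Y → EReal}
    {μ : ProbabilityMeasure X} {π : ProbabilityMeasure (X × Y)}
    (hπ : (π : Measure (X × Y)).fst = μ) (κ : Kernel X Y) [IsMarkovKernel κ]
    [hκ : (π : Measure (X × Y)).IsCondKernel κ] :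
    (∀ᵐ x ∂(μ : Measure X), condLaw π x = kernelLaw κ x) ∧
    weakCost C μ π = extIntegral (μ : Measure X) fun x => C x (kernelLaw κ x) := by
  have h : ∀ᵐ x ∂(μ : Measure X), condLaw π x = kernelLaw κ x := by
    rw [← hπ]
    filter_upwards [eq_condKernel_of_measure_eq_compProd κ
      ((π : Measure (X × Y)).disintegrate κ).symm] with x hx
    exact (kernelLaw_congr hx).symm
  exact ⟨h, extIntegral_congr_ae (h.mono fun x hx => by rw [hx])⟩

/-- The measure `μ ⊗ κ`, bundled. -/
noncomputable def compLaw {X Y : Type*} [MeasurableSpace X] [MeasurableSpace Y]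
    (μ : ProbabilityMeasure X) (κ : Kernel X Y) [IsMarkovKernel κ] : ProbabilityMeasure (X × Y) :=
  ⟨(μ : Measure X) ⊗ₘ κ, inferInstance⟩

theorem isCondKernel_compLaw {X Y : Type*} [MeasurableSpace X] [MeasurableSpace Y]
    (μ : ProbabilityMeasure X) (κ : Kernel X Y) [IsMarkovKernel κ] :
    (compLaw μ κ : Measure (X × Y)).IsCondKernel κ :=
  ⟨by
    change ((μ : Measure X) ⊗ₘ κ).fst ⊗ₘ κ = (μ : Measure X) ⊗ₘ κ
    rw [Measure.fst_compProd]⟩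

theorem IsWeakOptimizer.exists_swap_monotone_set [Nonempty Y] {μ : ProbabilityMeasure X}
    {ν : ProbabilityMeasure Y} {π : ProbabilityMeasure (X × Y)} (hbot : ∀ x m, C x m ≠ ⊥)
    (hC : Measurable fun z : X × ProbabilityMeasure Y => C z.1 z.2)
    (hconv : ∀ᵐ x ∂(μ : Measure X), ConvexOnLaws (C x) ∧ LowerSemicontinuous (C x))
    (hvt : weakValue C μ ν ≠ ⊤) (hvb : weakValue C μ ν ≠ ⊥) (hπ : IsWeakOptimizer C μ ν π)
    (κ : Kernel X Y) [IsMarkovKernel κ] (hκ : (π : Measure (X × Y)).IsCondKernel κ) :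
    ∃ Γ : Set X, MeasurableSet Γ ∧ (μ : Measure X) Γ = 1 ∧
      ∀ x ∈ Γ, ∀ x' ∈ Γ, ∀ m m' : ProbabilityMeasure Y,
        (m : Measure Y) + (m' : Measure Y) = κ x + κ x' →
        C x (kernelLaw κ x) + C x' (kernelLaw κ x') ≤ C x m + C x' m' := by
  obtain ⟨⟨hfst, hsnd⟩, hval⟩ := hπ
  have hcost := (weakCost_eq_of_isCondKernel (C := C) hfst κ).2
  rw [hval] at hcost
  have hmeas : Measurable fun x => C x (kernelLaw κ x) :=
    hC.comp (measurable_id.prodMk (measurable_kernelLaw κ))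
  obtain ⟨htop, -, hint, heq⟩ := extIntegral_eq_coe_of_finite hmeas.aemeasurable (hcost ▸ hvt)
    (hcost ▸ hvb)
  refine WeakTransport.exists_swap_monotone_set hbot hC hconv htop hint fun η _ hη => ?_
  rw [← heq, ← hcost]
  have := isCondKernel_compLaw μ η
  have hηfst : (compLaw μ η : Measure (X × Y)).fst = μ := Measure.fst_compProd _ _
  rw [← (weakCost_eq_of_isCondKernel (C := C) hηfst η).2]
  refine iInf₂_le (compLaw μ η) ⟨hηfst, ?_⟩
  change ((μ : Measure X) ⊗ₘ η).snd = ν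
  rw [Measure.snd_compProd, hη, ← hsnd]
  conv_rhs => rw [← (π : Measure (X × Y)).disintegrate κ, Measure.snd_compProd, hfst]

end SwapMonotone

/-! ### Weak limits and the moment cost -/

theorem lintegral_le_of_tendsto {Ω : Type*} [TopologicalSpace Ω] [MeasurableSpace Ω]
    [HasOuterApproxClosed Ω] [BorelSpace Ω] {m : ℕ → ProbabilityMeasure Ω}
    {m₀ : ProbabilityMeasure Ω} (h : Tendsto m atTop (𝓝 m₀)) {f : Ω → ℝ} (hf : Continuous f)
    (hf0 : 0 ≤ f) {c : ℕ → ℝ≥0∞} {c₀ : ℝ≥0∞} (hc : Tendsto c atTop (𝓝 c₀))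
    (hle : ∀ n, ∫⁻ x, ENNReal.ofReal (f x) ∂(m n : Measure Ω) ≤ c n) :
    ∫⁻ x, ENNReal.ofReal (f x) ∂(m₀ : Measure Ω) ≤ c₀ := by
  refine (lintegral_le_liminf_lintegral_of_forall_isOpen_measure_le_liminf_measure hf hf0
    fun u hu => ProbabilityMeasure.le_liminf_measure_open_of_tendsto h hu).trans ?_
  rw [← hc.liminf_eq]
  exact liminf_le_liminf (Eventually.of_forall hle)

section Cost

variable {E : Type*} [NormedAddCommGroup E]

/-- Bounds the second moment of a coupling by its cost, which gives tightness through Chebyshev's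
inequality. -/
theorem enorm_sq_le_of_prod (p : E × E) :
    ‖p‖ₑ ^ 2 ≤ 4 * (‖p.1‖ₑ ^ 2 + edist p.1 p.2 ^ 2) := by
  have key : ‖p‖ₑ ≤ 2 * max ‖p.1‖ₑ (edist p.1 p.2) := by
    have h2 : ‖p.2‖ₑ ≤ ‖p.1‖ₑ + edist p.1 p.2 := by
      rw [edist_comm, edist_eq_enorm_sub]
      simpa using enorm_add_le p.1 (p.2 - p.1)
    rw [← edist_zero_right, Prod.edist_eq, Prod.fst_zero, Prod.snd_zero, edist_zero_right,
      edist_zero_right, two_mul]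
    exact max_le ((le_max_left _ _).trans le_self_add)
      (h2.trans (add_le_add (le_max_left _ _) (le_max_right _ _)))
  calc ‖p‖ₑ ^ 2 ≤ (2 * max ‖p.1‖ₑ (edist p.1 p.2)) ^ 2 := by gcongr
    _ = 4 * (max ‖p.1‖ₑ (edist p.1 p.2)) ^ 2 := by rw [mul_pow]; norm_num
    _ ≤ 4 * (‖p.1‖ₑ ^ 2 + edist p.1 p.2 ^ 2) := by
        gcongr
        rcases max_choice ‖p.1‖ₑ (edist p.1 p.2) with h | h <;> rw [h]
        · exact le_self_add
        · exact le_add_self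

variable [MeasurableSpace E]

/-- The second moment of `m` plus the squared Wasserstein distance of `m` and `n`. -/
noncomputable def momentCost (n m : ProbabilityMeasure E) : ℝ≥0∞ :=
  ⨅ q ∈ couplings m n, ∫⁻ p, (‖p.1‖ₑ ^ 2 + edist p.1 p.2 ^ 2) ∂(q : Measure (E × E))

/-- Couplings of m₁ and m₂ with the common second marginal n mix to a coupling of m with n, and the
cost is linear in the coupling. -/
theorem momentCost_convex {n m₁ m₂ m : ProbabilityMeasure E} {a b : ℝ≥0} (ha : a ≠ 0)
    (hb : b ≠ 0) (hab : a + b = 1)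
    (hm : (m : Measure E) = a • (m₁ : Measure E) + b • (m₂ : Measure E)) :
    momentCost n m ≤ a * momentCost n m₁ + b * momentCost n m₂ := by
  have hinf : ∀ m' : ProbabilityMeasure E, momentCost n m' =
      ⨅ q : couplings m' n, ∫⁻ p, (‖p.1‖ₑ ^ 2 + edist p.1 p.2 ^ 2) ∂(q.1 : Measure (E × E)) :=
    fun m' => iInf_subtype'
  rw [hinf, hinf, hinf, ENNReal.mul_iInf_of_ne (by simpa using ha) (by simp),
    ENNReal.mul_iInf_of_ne (by simpa using hb) (by simp), ENNReal.iInf_add]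
  refine le_iInf fun q₁ => ?_
  rw [ENNReal.add_iInf]
  refine le_iInf fun q₂ => ?_
  have hab' : (a : ℝ≥0∞) + b = 1 := by exact_mod_cast hab
  let q : ProbabilityMeasure (E × E) :=
    ⟨a • (q₁.1 : Measure (E × E)) + b • (q₂.1 : Measure (E × E)), ⟨by
      change (a : ℝ≥0∞) * (q₁.1 : Measure (E × E)) univ + b * (q₂.1 : Measure (E × E)) univ = 1
      rw [measure_univ, measure_univ, mul_one, mul_one, hab']⟩⟩
  have hq : q ∈ couplings m n := by
    obtain ⟨h11, h12⟩ := q₁.2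
    obtain ⟨h21, h22⟩ := q₂.2
    rw [Measure.fst] at h11 h21
    rw [Measure.snd] at h12 h22
    constructor
    · change Measure.map _ (a • (q₁.1 : Measure (E × E)) + b • (q₂.1 : Measure (E × E))) = _
      rw [Measure.map_add _ _ measurable_fst, Measure.map_smul, Measure.map_smul, h11, h21, hm]
    · change Measure.map _ (a • (q₁.1 : Measure (E × E)) + b • (q₂.1 : Measure (E × E))) = _
      rw [Measure.map_add _ _ measurable_snd, Measure.map_smul, Measure.map_smul, h12, h22,
        ← add_smul, hab, one_smul]
  refine (iInf_le _ ⟨q, hq⟩).trans (le_of_eq ?_)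
  change ∫⁻ p, _ ∂(a • (q₁.1 : Measure (E × E)) + b • (q₂.1 : Measure (E × E))) = _
  rw [lintegral_add_measure, lintegral_smul_measure, lintegral_smul_measure]
  rfl

variable [BorelSpace E]

theorem isTightMeasureSet_of_lintegral_le [SecondCountableTopology E] [ProperSpace E] {T : ℝ≥0∞}
    (hT : T ≠ ⊤) :
    IsTightMeasureSet {q : Measure (E × E) |
      ∫⁻ p, (‖p.1‖ₑ ^ 2 + edist p.1 p.2 ^ 2) ∂q ≤ T} := by
  refine isTightMeasureSet_of_tendsto_measure_norm_gt ?_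
  have hlim : Tendsto (fun r : ℝ => 4 * T / ENNReal.ofReal (r ^ 2)) atTop (𝓝 0) := by
    have h1 : Tendsto (fun r : ℝ => ENNReal.ofReal (r ^ 2)) atTop (𝓝 ⊤) :=
      ENNReal.tendsto_ofReal_atTop.comp (tendsto_pow_atTop two_ne_zero)
    have := ENNReal.Tendsto.const_div h1 (a := 4 * T) (Or.inr (by finiteness))
    simpa using this
  refine tendsto_of_tendsto_of_tendsto_of_le_of_le' tendsto_const_nhds hlim
    (Eventually.of_forall fun _ => zero_le) ?_
  filter_upwards [eventually_gt_atTop 0] with r hr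
  refine iSup₂_le fun q hq => ?_
  rw [ENNReal.le_div_iff_mul_le (Or.inl (by positivity)) (Or.inl (by simp)),
    mul_comm]
  calc ENNReal.ofReal (r ^ 2) * q {x | r < ‖x‖}
      ≤ ENNReal.ofReal (r ^ 2) * q {x | ENNReal.ofReal (r ^ 2) ≤ ‖x‖ₑ ^ 2} := by
        gcongr with x
        intro hx
        rw [← ofReal_norm, ← ENNReal.ofReal_pow (norm_nonneg _)]
        gcongr
    _ ≤ ∫⁻ x, ‖x‖ₑ ^ 2 ∂q := mul_meas_ge_le_lintegral (by fun_prop) _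
    _ ≤ ∫⁻ p, 4 * (‖p.1‖ₑ ^ 2 + edist p.1 p.2 ^ 2) ∂q := lintegral_mono enorm_sq_le_of_prod
    _ = 4 * ∫⁻ p, (‖p.1‖ₑ ^ 2 + edist p.1 p.2 ^ 2) ∂q := lintegral_const_mul _ (by fun_prop)
    _ ≤ 4 * T := by gcongr

theorem momentCost_le_of_tendsto [SecondCountableTopology E] [ProperSpace E]
    {n m₀ : ProbabilityMeasure E} {m : ℕ → ProbabilityMeasure E} (h : Tendsto m atTop (𝓝 m₀))
    {t : ℝ≥0∞} (hle : ∀ k, momentCost n (m k) ≤ t) : momentCost n m₀ ≤ t := by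
  rcases eq_or_ne t ⊤ with rfl | ht
  · exact le_top
  have hex : ∀ k : ℕ, ∃ q ∈ couplings (m k) n,
      ∫⁻ p, (‖p.1‖ₑ ^ 2 + edist p.1 p.2 ^ 2) ∂(q : Measure (E × E)) ≤
        t + ((k + 1 : ℕ) : ℝ≥0∞)⁻¹ := by
    intro k
    have hlt : momentCost n (m k) < t + ((k + 1 : ℕ) : ℝ≥0∞)⁻¹ :=
      (hle k).trans_lt (ENNReal.lt_add_right ht (by simp))
    obtain ⟨q, hq⟩ := iInf_lt_iff.1 hlt
    obtain ⟨hq1, hq2⟩ := iInf_lt_iff.1 hq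
    exact ⟨q, hq1, hq2.le⟩
  choose q hq hqt using hex
  -- The near-optimal couplings have cost at most t + 1, the errors being at most 1. By Prokhorov a
  -- subsequence converges; its limit has marginals m₀ and n, and costs no more than t.
  have htight := isTightMeasureSet_of_lintegral_le (E := E) (T := t + 1) (by finiteness)
  have hcomp := isCompact_closure_of_isTightMeasureSet (S := range q) (htight.subset (by
    rintro _ ⟨_, ⟨k, rfl⟩, rfl⟩
    refine (hqt k).trans ?_
    gcongr
    simp))
  obtain ⟨q₀, -, φ, hφ, hlim⟩ := hcomp.tendsto_subseq fun k => subset_closure (mem_range_self k)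
  have hcm : Tendsto (fun k : ℕ => t + ((φ k + 1 : ℕ) : ℝ≥0∞)⁻¹) atTop (𝓝 t) := by
    have h1 : Tendsto (fun k : ℕ => t + ((k + 1 : ℕ) : ℝ≥0∞)⁻¹) atTop (𝓝 (t + 0)) :=
      tendsto_const_nhds.add
        (ENNReal.tendsto_inv_nat_nhds_zero.comp (tendsto_add_atTop_nat 1))
    rw [add_zero] at h1
    exact h1.comp hφ.tendsto_atTop
  have hfst : q₀.map measurable_fst.aemeasurable = m₀ := by
    refine tendsto_nhds_unique (ProbabilityMeasure.tendsto_map_of_tendsto_of_continuous _ _ hlim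
      continuous_fst) ((h.comp hφ.tendsto_atTop).congr fun k => Subtype.ext ?_)
    exact (hq (φ k)).1.symm
  have hsnd : q₀.map measurable_snd.aemeasurable = n := by
    refine tendsto_nhds_unique (ProbabilityMeasure.tendsto_map_of_tendsto_of_continuous _ _ hlim
      continuous_snd) (tendsto_const_nhds.congr fun k => Subtype.ext ?_)
    exact (hq (φ k)).2.symm
  refine (iInf₂_le q₀ ⟨congrArg Subtype.val hfst, congrArg Subtype.val hsnd⟩).trans ?_
  have he : ∀ p : E × E, ‖p.1‖ₑ ^ 2 + edist p.1 p.2 ^ 2 =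
      ENNReal.ofReal (‖p.1‖ ^ 2 + dist p.1 p.2 ^ 2) := fun p => by
    rw [ENNReal.ofReal_add (by positivity) (by positivity), ENNReal.ofReal_pow (by positivity),
      ENNReal.ofReal_pow (by positivity), ofReal_norm, edist_dist]
  simp only [he] at hqt ⊢
  exact lintegral_le_of_tendsto hlim (by fun_prop) (fun p => by positivity) hcm fun k => hqt (φ k)

theorem lowerSemicontinuous_momentCost [SecondCountableTopology E] [ProperSpace E]
    (n : ProbabilityMeasure E) : LowerSemicontinuous (momentCost n) := by
  refine lowerSemicontinuous_iff_isClosed_preimage.2 fun t => IsSeqClosed.isClosed ?_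
  exact fun m m₀ hm hlim => momentCost_le_of_tendsto hlim hm

end Cost

/-! ### Second moments -/

section Moments

variable {E : Type*} [NormedAddCommGroup E]

theorem memLp_two_of_lintegral_ne_top {Ω : Type*} [MeasurableSpace Ω] {μ : Measure Ω} {f : Ω → E}
    (hf : AEStronglyMeasurable f μ) (h : ∫⁻ x, ‖f x‖ₑ ^ 2 ∂μ ≠ ⊤) : MemLp f 2 μ := by
  refine ⟨hf, (eLpNorm_lt_top_iff_lintegral_rpow_enorm_lt_top two_ne_zero (by simp)).2 ?_⟩
  simpa using h.lt_top

theorem lintegral_ne_top_of_memLp_two {Ω : Type*} [MeasurableSpace Ω] {μ : Measure Ω} {f : Ω → E}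
    (h : MemLp f 2 μ) : ∫⁻ x, ‖f x‖ₑ ^ 2 ∂μ ≠ ⊤ := by
  have := (eLpNorm_lt_top_iff_lintegral_rpow_enorm_lt_top two_ne_zero (by simp)).1 h.2
  simpa using this.ne

variable [MeasurableSpace E] [BorelSpace E]

/-- The second moment. -/
noncomputable def secondMoment (m : ProbabilityMeasure E) : ℝ≥0∞ :=
  ∫⁻ y, ‖y‖ₑ ^ 2 ∂(m : Measure E)

theorem secondMoment_le_momentCost (n m : ProbabilityMeasure E) :
    secondMoment m ≤ momentCost n m := by
  refine le_iInf₂ fun q hq => ?_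
  rw [secondMoment, ← hq.1, Measure.fst, lintegral_map (by fun_prop) measurable_fst]
  exact lintegral_mono fun p => le_self_add

end Moments

/-! ### The cost with the martingale constraint -/

section Euclidean

variable {d : ℕ}

local notation "𝔼" => EuclideanSpace ℝ (Fin d)

theorem memLp_two_id_of_secondMoment {m : ProbabilityMeasure 𝔼} (h : secondMoment m ≠ ⊤) :
    MemLp id 2 (m : Measure 𝔼) :=
  memLp_two_of_lintegral_ne_top aestronglyMeasurable_id h

theorem measurableSet_hasMean :
    MeasurableSet {z : 𝔼 × ProbabilityMeasure 𝔼 | HasMean z.2 z.1} := by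
  have h1 : MeasurableSet {z : 𝔼 × ProbabilityMeasure 𝔼 |
      Integrable id (z.2 : Measure 𝔼)} := by
    have : Measurable fun z : 𝔼 × ProbabilityMeasure 𝔼 => ∫⁻ y, ‖y‖ₑ ∂(z.2 : Measure 𝔼) :=
      (Measure.measurable_lintegral (by fun_prop)).comp
        (measurable_subtype_coe.comp measurable_snd)
    convert measurableSet_lt this (measurable_const (a := (⊤ : ℝ≥0∞))) using 1
    ext z
    exact ⟨fun h => h.2, fun h => ⟨aestronglyMeasurable_id, h⟩⟩
  have h2 : Measurable fun z : 𝔼 × ProbabilityMeasure 𝔼 => ∫ y, y ∂(z.2 : Measure 𝔼) := by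
    have : StronglyMeasurable fun m : ProbabilityMeasure 𝔼 => ∫ y, y ∂(lawKernel 𝔼 m) :=
      StronglyMeasurable.integral_kernel (κ := lawKernel 𝔼) stronglyMeasurable_id
    exact this.measurable.comp measurable_snd
  exact h1.inter (measurableSet_eq_fun h2 measurable_fst)

/-- Weak limits alone need not preserve means; bounded second moments supply the missing uniform
integrability. -/
theorem HasMean.of_tendsto {m₀ : ProbabilityMeasure 𝔼} {m : ℕ → ProbabilityMeasure 𝔼} {x : 𝔼}
    (h : Tendsto m atTop (𝓝 m₀)) {T : ℝ} (hT : 0 ≤ T) (hm : ∀ k, HasMean (m k) x)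
    (hle : ∀ k, secondMoment (m k) ≤ ENNReal.ofReal T) : HasMean m₀ x := by
  have hsq : ∀ y : 𝔼, ‖y‖ₑ ^ 2 = ENNReal.ofReal (‖y‖ ^ 2) := fun y => by
    rw [ENNReal.ofReal_pow (norm_nonneg _), ofReal_norm]
  have h0 : secondMoment m₀ ≤ ENNReal.ofReal T := by
    simp only [secondMoment, hsq] at hle ⊢
    exact lintegral_le_of_tendsto h (by fun_prop) (fun y => by positivity) tendsto_const_nhds hle
  have hint : ∀ {m : ProbabilityMeasure 𝔼}, secondMoment m ≤ ENNReal.ofReal T →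
      Integrable (fun y => y) (m : Measure 𝔼) ∧ Integrable (fun y => ‖y‖ ^ 2) (m : Measure 𝔼) ∧
      ∫ y, ‖y‖ ^ 2 ∂(m : Measure 𝔼) ≤ T := by
    intro m hm
    have := memLp_two_id_of_secondMoment (hm.trans_lt ENNReal.ofReal_lt_top).ne
    refine ⟨this.integrable one_le_two, this.integrable_norm_pow two_ne_zero, ?_⟩
    rw [integral_eq_lintegral_of_nonneg_ae (Eventually.of_forall fun y => by positivity)
      (by fun_prop)]
    refine ENNReal.toReal_le_of_le_ofReal hT ?_
    simpa only [secondMoment, hsq] using hm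
  refine ⟨(hint h0).1, ?_⟩
  have key : ∀ u : 𝔼, inner ℝ u (∫ y, y ∂(m₀ : Measure 𝔼)) ≤ inner ℝ u x := by
    intro u
    refine le_of_forall_pos_le_add fun ε hε => ?_
    obtain ⟨δ, hδ, hδT⟩ : ∃ δ > 0, δ * T ≤ ε := by
      refine ⟨ε / (T + 1), by positivity, ?_⟩
      rw [div_mul_eq_mul_div, div_le_iff₀ (by positivity)]
      nlinarith
    -- Completing the square makes the linear function nonnegative at the price of δ‖y‖², so
    -- semicontinuity of nonnegative integrals applies. The quadratic term contributes at most δT ≤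
    -- ε; testing both u and -u gives equality of means.
    let f : 𝔼 → ℝ := fun y => δ * ‖y‖ ^ 2 + inner ℝ u y + ‖u‖ ^ 2 / (4 * δ)
    have hf0 : 0 ≤ f := fun y => by
      have h1 := neg_le_of_abs_le (abs_real_inner_le_norm u y)
      have h2 : δ * ‖y‖ ^ 2 - ‖u‖ * ‖y‖ + ‖u‖ ^ 2 / (4 * δ) = δ * (‖y‖ - ‖u‖ / (2 * δ)) ^ 2 := by
        field_simp
        ring
      have h3 : 0 ≤ δ * (‖y‖ - ‖u‖ / (2 * δ)) ^ 2 := by positivity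
      simp only [f, Pi.zero_apply]
      linarith
    have hfint : ∀ {m : ProbabilityMeasure 𝔼}, secondMoment m ≤ ENNReal.ofReal T →
        Integrable f (m : Measure 𝔼) ∧ ∫ y, f y ∂(m : Measure 𝔼) =
          δ * ∫ y, ‖y‖ ^ 2 ∂(m : Measure 𝔼) + inner ℝ u (∫ y, y ∂(m : Measure 𝔼)) +
            ‖u‖ ^ 2 / (4 * δ) := by
      intro m hm
      obtain ⟨i1, i2, -⟩ := hint hm
      have i3 : Integrable (fun y => inner ℝ u y) (m : Measure 𝔼) := i1.const_inner u
      have i4 : Integrable (fun y => δ * ‖y‖ ^ 2 + inner ℝ u y) (m : Measure 𝔼) :=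
        (i2.const_mul δ).add i3
      refine ⟨i4.add (integrable_const _), ?_⟩
      simp only [f]
      rw [integral_add i4 (integrable_const _),
        integral_add (i2.const_mul δ) i3, integral_const_mul, integral_inner i1]
      simp
    have hlim : ∫⁻ y, ENNReal.ofReal (f y) ∂(m₀ : Measure 𝔼) ≤
        ENNReal.ofReal (δ * T + inner ℝ u x + ‖u‖ ^ 2 / (4 * δ)) := by
      refine lintegral_le_of_tendsto h (by fun_prop) hf0 tendsto_const_nhds fun k => ?_
      rw [← ofReal_integral_eq_lintegral_ofReal (hfint (hle k)).1 (Eventually.of_forall hf0),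
        (hfint (hle k)).2, (hm k).2]
      gcongr
      exact (hint (hle k)).2.2
    rw [← ofReal_integral_eq_lintegral_ofReal (hfint h0).1 (Eventually.of_forall hf0),
      (hfint h0).2] at hlim
    have hpos : 0 ≤ δ * T + inner ℝ u x + ‖u‖ ^ 2 / (4 * δ) := by
      have h1 : 0 ≤ ∫ y, f y ∂(m 0 : Measure 𝔼) := integral_nonneg hf0
      rw [(hfint (hle 0)).2, (hm 0).2] at h1
      have := mul_le_mul_of_nonneg_left (hint (hle 0)).2.2 hδ.le
      linarith
    have := (ENNReal.ofReal_le_ofReal_iff hpos).1 hlim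
    have h2 : 0 ≤ δ * ∫ y, ‖y‖ ^ 2 ∂(m₀ : Measure 𝔼) := by positivity
    linarith
  refine ext_inner_left ℝ fun u => le_antisymm (key u) ?_
  have := key (-u)
  rw [inner_neg_left, inner_neg_left] at this
  linarith

open Classical in
/-- The moment cost with the constraint that the law has mean `x`. -/
noncomputable def martingaleCost (n : ProbabilityMeasure 𝔼) (x : 𝔼) (m : ProbabilityMeasure 𝔼) :
    EReal :=
  if HasMean m x then (momentCost n m : EReal) else ⊤

theorem martingaleCost_ne_bot (n : ProbabilityMeasure 𝔼) (x : 𝔼) (m : ProbabilityMeasure 𝔼) :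
    martingaleCost n x m ≠ ⊥ := by
  unfold martingaleCost
  split_ifs
  · exact EReal.coe_ennreal_ne_bot _
  · exact top_ne_bot

theorem measurable_martingaleCost (n : ProbabilityMeasure 𝔼) :
    Measurable fun z : 𝔼 × ProbabilityMeasure 𝔼 => martingaleCost n z.1 z.2 :=
  Measurable.ite measurableSet_hasMean
    (((lowerSemicontinuous_momentCost n).measurable.comp measurable_snd).coe_ereal_ennreal)
    measurable_const

/-- On a sublevel set below ⊤ the second moments are bounded by the cost, so the mean constraint
survives weak limits. -/
theorem lowerSemicontinuous_martingaleCost (n : ProbabilityMeasure 𝔼) (x : 𝔼) :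
    LowerSemicontinuous (martingaleCost n x) := by
  refine lowerSemicontinuous_iff_isClosed_preimage.2 fun t => ?_
  rcases eq_or_ne t ⊤ with rfl | ht
  · simp
  refine IsSeqClosed.isClosed fun m m₀ hm hlim => ?_
  have hsub : ∀ k, HasMean (m k) x ∧ (momentCost n (m k) : EReal) ≤ t := by
    intro k
    have hk : martingaleCost n x (m k) ≤ t := hm k
    unfold martingaleCost at hk
    split_ifs at hk with h
    · exact ⟨h, hk⟩
    · exact absurd (top_le_iff.1 hk) ht
  have ht0 : 0 ≤ t := (EReal.coe_ennreal_nonneg _).trans (hsub 0).2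
  have hle : ∀ k, momentCost n (m k) ≤ t.toENNReal := fun k => by
    rw [← EReal.coe_ennreal_le_coe_ennreal_iff, EReal.coe_toENNReal ht0]
    exact (hsub k).2
  have htt : t.toENNReal ≠ ⊤ := EReal.toENNReal_ne_top_iff.2 ht
  have hmean : HasMean m₀ x := by
    refine HasMean.of_tendsto hlim (T := t.toENNReal.toReal) ENNReal.toReal_nonneg
      (fun k => (hsub k).1) fun k => ?_
    rw [ENNReal.ofReal_toReal htt]
    exact (secondMoment_le_momentCost n _).trans (hle k)
  change martingaleCost n x m₀ ≤ t
  rw [martingaleCost, if_pos hmean, ← EReal.coe_toENNReal ht0,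
    EReal.coe_ennreal_le_coe_ennreal_iff]
  exact momentCost_le_of_tendsto hlim hle

theorem convexOnLaws_martingaleCost (n : ProbabilityMeasure 𝔼) (x : 𝔼) :
    ConvexOnLaws (martingaleCost n x) := by
  intro m₁ m₂ m a b hab hm
  -- Zero weights are treated apart: in `EReal`, 0 · ⊤ = 0, so the argument that an infinite cost
  -- makes the right side ⊤ needs positive weights.
  rcases eq_or_ne a 0 with rfl | ha
  · rw [zero_add] at hab
    have : m = m₂ := Subtype.ext (by simpa [hab] using hm)
    simp [this, hab]
  rcases eq_or_ne b 0 with rfl | hb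
  · rw [add_zero] at hab
    have : m = m₁ := Subtype.ext (by simpa [hab] using hm)
    simp [this, hab]
  have ha' : (0 : EReal) < ((a : ℝ) : EReal) := by exact_mod_cast pos_iff_ne_zero.2 ha
  have hb' : (0 : EReal) < ((b : ℝ) : EReal) := by exact_mod_cast pos_iff_ne_zero.2 hb
  have hbot : ∀ (c : ℝ≥0) (m : ProbabilityMeasure 𝔼),
      ((c : ℝ) : EReal) * martingaleCost n x m ≠ ⊥ := by
    intro c m
    refine (lt_of_lt_of_le EReal.bot_lt_zero (EReal.mul_nonneg (by exact_mod_cast c.2) ?_)).ne'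
    unfold martingaleCost
    split_ifs
    · exact EReal.coe_ennreal_nonneg _
    · exact le_top
  by_cases h₁ : HasMean m₁ x
  swap
  · have : martingaleCost n x m₁ = ⊤ := if_neg h₁
    rw [this, EReal.mul_top_of_pos ha', EReal.top_add_of_ne_bot (hbot _ _)]
    exact le_top
  by_cases h₂ : HasMean m₂ x
  swap
  · have : martingaleCost n x m₂ = ⊤ := if_neg h₂
    rw [this, EReal.mul_top_of_pos hb', EReal.add_top_of_ne_bot (hbot _ _)]
    exact le_top
  have hmean : HasMean m x := by
    have i1 : Integrable id (a • (m₁ : Measure 𝔼)) := h₁.1.smul_measure_nnreal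
    have i2 : Integrable id (b • (m₂ : Measure 𝔼)) := h₂.1.smul_measure_nnreal
    refine ⟨hm ▸ i1.add_measure i2, ?_⟩
    rw [hm]
    refine (integral_add_measure i1 i2).trans ?_
    simp only [id]
    rw [integral_smul_nnreal_measure, integral_smul_nnreal_measure, h₁.2, h₂.2, ← add_smul, hab,
      one_smul]
  rw [martingaleCost, martingaleCost, martingaleCost, if_pos h₁, if_pos h₂, if_pos hmean]
  have := momentCost_convex ha hb hab hm (n := n)
  rw [← EReal.coe_ennreal_le_coe_ennreal_iff, EReal.coe_ennreal_add, EReal.coe_ennreal_mul,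
    EReal.coe_ennreal_mul] at this
  exact this

end Euclidean

/-! ### From covariance maximization to two-point Wasserstein optimality -/

section Bass

variable {d : ℕ}

local notation "𝔼" => EuclideanSpace ℝ (Fin d)

theorem momentCost_eq_add_wasserstein2 (n m : ProbabilityMeasure 𝔼) :
    momentCost n m = secondMoment m + wasserstein2 m n ^ 2 := by
  have hsq : wasserstein2 m n ^ 2 =
      ⨅ q ∈ couplings m n, ∫⁻ p, edist p.1 p.2 ^ 2 ∂(q : Measure (𝔼 × 𝔼)) := by
    rw [wasserstein2, ← ENNReal.rpow_natCast, ← ENNReal.rpow_mul]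
    norm_num
  rw [hsq, ENNReal.add_iInf₂, momentCost]
  refine iInf_congr fun q => iInf_congr fun hq => ?_
  rw [lintegral_add_left (by fun_prop), secondMoment, ← hq.1, Measure.fst,
    lintegral_map (by fun_prop) measurable_fst]

theorem integral_norm_sq_eq {Ω : Type*} [MeasurableSpace Ω] {q : Measure Ω} {f : Ω → 𝔼}
    (hf : Measurable f) {m : ProbabilityMeasure 𝔼} (hm : q.map f = m) :
    ∫ p, ‖f p‖ ^ 2 ∂q = (secondMoment m).toReal := by
  rw [integral_eq_lintegral_of_nonneg_ae (Eventually.of_forall fun y => by positivity)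
    (by fun_prop), secondMoment, ← hm, lintegral_map (by fun_prop) hf]
  simp only [ENNReal.ofReal_pow (norm_nonneg _), ofReal_norm]

theorem coupling_covariance {m n : ProbabilityMeasure 𝔼} (hm : secondMoment m ≠ ⊤)
    (hn : secondMoment n ≠ ⊤) {q : ProbabilityMeasure (𝔼 × 𝔼)} (hq : q ∈ couplings m n) :
    ∃ r : ℝ, extIntegral (q : Measure (𝔼 × 𝔼)) (fun p => ((inner ℝ p.1 p.2 : ℝ) : EReal)) = r ∧
      |2 * r| ≤ (secondMoment m).toReal + (secondMoment n).toReal ∧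
      ∫⁻ p, (‖p.1‖ₑ ^ 2 + edist p.1 p.2 ^ 2) ∂(q : Measure (𝔼 × 𝔼)) =
        ENNReal.ofReal (2 * (secondMoment m).toReal + (secondMoment n).toReal - 2 * r) := by
  have h1 : MemLp (fun p : 𝔼 × 𝔼 => p.1) 2 (q : Measure (𝔼 × 𝔼)) :=
    (memLp_map_measure_iff aestronglyMeasurable_id measurable_fst.aemeasurable).1
      (by rw [← Measure.fst, hq.1]; exact memLp_two_id_of_secondMoment hm)
  have h2 : MemLp (fun p : 𝔼 × 𝔼 => p.2) 2 (q : Measure (𝔼 × 𝔼)) :=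
    (memLp_map_measure_iff aestronglyMeasurable_id measurable_snd.aemeasurable).1
      (by rw [← Measure.snd, hq.2]; exact memLp_two_id_of_secondMoment hn)
  have s1 : ∫ p, ‖p.1‖ ^ 2 ∂(q : Measure (𝔼 × 𝔼)) = (secondMoment m).toReal :=
    integral_norm_sq_eq measurable_fst hq.1
  have s2 : ∫ p, ‖p.2‖ ^ 2 ∂(q : Measure (𝔼 × 𝔼)) = (secondMoment n).toReal :=
    integral_norm_sq_eq measurable_snd hq.2
  have i1 : Integrable (fun p : 𝔼 × 𝔼 => ‖p.1‖ ^ 2) (q : Measure (𝔼 × 𝔼)) :=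
    h1.integrable_norm_pow two_ne_zero
  have i2 : Integrable (fun p : 𝔼 × 𝔼 => ‖p.2‖ ^ 2) (q : Measure (𝔼 × 𝔼)) :=
    h2.integrable_norm_pow two_ne_zero
  have hb : ∀ p : 𝔼 × 𝔼, |2 * (inner ℝ p.1 p.2 : ℝ)| ≤ ‖p.1‖ ^ 2 + ‖p.2‖ ^ 2 := fun p => by
    rw [abs_mul, abs_two]
    have := abs_real_inner_le_norm p.1 p.2
    nlinarith [sq_nonneg (‖p.1‖ - ‖p.2‖)]
  have i12 : Integrable (fun p : 𝔼 × 𝔼 => ‖p.1‖ ^ 2 + ‖p.2‖ ^ 2) (q : Measure (𝔼 × 𝔼)) :=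
    i1.add i2
  have i4 : Integrable (fun p : 𝔼 × 𝔼 => 2 * (inner ℝ p.1 p.2 : ℝ)) (q : Measure (𝔼 × 𝔼)) :=
    i12.mono' (by fun_prop) (Eventually.of_forall fun p => hb p)
  have i3 : Integrable (fun p : 𝔼 × 𝔼 => (inner ℝ p.1 p.2 : ℝ)) (q : Measure (𝔼 × 𝔼)) := by
    simpa using i4.const_mul (1 / 2)
  have e4 : ∫ p : 𝔼 × 𝔼, 2 * (inner ℝ p.1 p.2 : ℝ) ∂(q : Measure (𝔼 × 𝔼)) =
      2 * ∫ p, inner ℝ p.1 p.2 ∂(q : Measure (𝔼 × 𝔼)) := integral_const_mul _ _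
  refine ⟨∫ p, inner ℝ p.1 p.2 ∂(q : Measure (𝔼 × 𝔼)), extIntegral_coe i3, ?_, ?_⟩
  · rw [← e4, ← s1, ← s2, ← integral_add i1 i2]
    exact norm_integral_le_of_norm_le (f := fun p : 𝔼 × 𝔼 => 2 * (inner ℝ p.1 p.2 : ℝ)) i12
      (Eventually.of_forall fun p => hb p)
  · have i5 : Integrable (fun p : 𝔼 × 𝔼 => 2 * ‖p.1‖ ^ 2 + ‖p.2‖ ^ 2) (q : Measure (𝔼 × 𝔼)) :=
      (i1.const_mul 2).add i2
    have e5 : ∫ p : 𝔼 × 𝔼, (2 * ‖p.1‖ ^ 2 + ‖p.2‖ ^ 2 - 2 * (inner ℝ p.1 p.2 : ℝ))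
        ∂(q : Measure (𝔼 × 𝔼)) = 2 * (secondMoment m).toReal + (secondMoment n).toReal -
          2 * ∫ p, inner ℝ p.1 p.2 ∂(q : Measure (𝔼 × 𝔼)) := by
      rw [integral_sub i5 i4, integral_add (i1.const_mul 2) i2, integral_const_mul, e4, s1, s2]
    have hsq : ∀ p : 𝔼 × 𝔼, 2 * ‖p.1‖ ^ 2 + ‖p.2‖ ^ 2 - 2 * (inner ℝ p.1 p.2 : ℝ) =
        ‖p.1‖ ^ 2 + dist p.1 p.2 ^ 2 := fun p => by
      rw [dist_eq_norm, norm_sub_sq_real]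
      ring
    have i7 : Integrable (fun p : 𝔼 × 𝔼 => ‖p.1‖ ^ 2 + dist p.1 p.2 ^ 2)
        (q : Measure (𝔼 × 𝔼)) := (i5.sub i4).congr (Eventually.of_forall hsq)
    rw [← e5, integral_congr_ae (Eventually.of_forall hsq), ofReal_integral_eq_lintegral_ofReal i7
      (Eventually.of_forall fun p => by positivity)]
    refine lintegral_congr fun p => ?_
    rw [ENNReal.ofReal_add (by positivity) (by positivity),
      ENNReal.ofReal_pow (by positivity), ENNReal.ofReal_pow (by positivity), ofReal_norm,
      edist_dist]

theorem prod_mem_couplings {X Y : Type*} [MeasurableSpace X] [MeasurableSpace Y]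
    (μ : ProbabilityMeasure X) (ν : ProbabilityMeasure Y) : μ.prod ν ∈ couplings μ ν :=
  ⟨by simp, by simp⟩

/-- Cost and covariance of a coupling are tied by an affine identity, so the infimum of one is
governed by the supremum of the other. The product coupling, with |2r₀| at most the sum of the
second moments, gives finiteness and the coefficients 3 and 2 that later serve as an integrable
bound. -/
theorem exists_maxCov_eq {m n : ProbabilityMeasure 𝔼} (hm : secondMoment m ≠ ⊤)
    (hn : secondMoment n ≠ ⊤) :
    ∃ r : ℝ, maxCov m n = r ∧ momentCost n m ≠ ⊤ ∧
      (momentCost n m).toReal = 2 * (secondMoment m).toReal + (secondMoment n).toReal - 2 * r ∧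
      (momentCost n m).toReal ≤ 3 * (secondMoment m).toReal + 2 * (secondMoment n).toReal := by
  obtain ⟨r₀, hr₀, hb₀, hI₀⟩ := coupling_covariance hm hn (prod_mem_couplings m n)
  have hJ₀ : momentCost n m ≤
      ENNReal.ofReal (2 * (secondMoment m).toReal + (secondMoment n).toReal - 2 * r₀) :=
    hI₀ ▸ iInf₂_le _ (prod_mem_couplings m n)
  have htop : momentCost n m ≠ ⊤ := (hJ₀.trans_lt ENNReal.ofReal_lt_top).ne
  have ha := ENNReal.toReal_nonneg (a := secondMoment m)
  have hb := ENNReal.toReal_nonneg (a := secondMoment n)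
  have hle : maxCov m n ≤ ((((2 * (secondMoment m).toReal + (secondMoment n).toReal -
      (momentCost n m).toReal) / 2 : ℝ)) : EReal) := by
    refine iSup₂_le fun q hq => ?_
    obtain ⟨r, hr, hbr, hI⟩ := coupling_covariance hm hn hq
    rw [hr, EReal.coe_le_coe_iff]
    have h1 : momentCost n m ≤ ENNReal.ofReal
        (2 * (secondMoment m).toReal + (secondMoment n).toReal - 2 * r) := hI ▸ iInf₂_le q hq
    have h2 := ENNReal.toReal_le_of_le_ofReal (by linarith [(abs_le.1 hbr).2]) h1
    linarith
  have hge : (r₀ : EReal) ≤ maxCov m n := hr₀ ▸ le_iSup₂ (f := fun q (_ : q ∈ couplings m n) =>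
    extIntegral (q : Measure (𝔼 × 𝔼)) fun p => ((inner ℝ p.1 p.2 : ℝ) : EReal)) _
      (prod_mem_couplings m n)
  obtain ⟨r, hr⟩ : ∃ r : ℝ, maxCov m n = r := by
    refine ⟨(maxCov m n).toReal, (EReal.coe_toReal ?_ ?_).symm⟩
    · exact (hle.trans_lt (EReal.coe_lt_top _)).ne
    · exact ((EReal.bot_lt_coe _).trans_le hge).ne'
  have h2 : ENNReal.ofReal (2 * (secondMoment m).toReal + (secondMoment n).toReal - 2 * r) ≤
      momentCost n m := by
    refine le_iInf₂ fun q hq => ?_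
    obtain ⟨s, hs, hbs, hI⟩ := coupling_covariance hm hn hq
    rw [hI]
    have : (s : EReal) ≤ r := hr ▸ hs ▸ le_iSup₂ (f := fun q (_ : q ∈ couplings m n) =>
      extIntegral (q : Measure (𝔼 × 𝔼)) fun p => ((inner ℝ p.1 p.2 : ℝ) : EReal)) q hq
    have := EReal.coe_le_coe_iff.1 this
    gcongr
  rw [hr, EReal.coe_le_coe_iff] at hle
  refine ⟨r, hr, htop, le_antisymm (by linarith) ?_, ?_⟩
  · exact (ENNReal.ofReal_le_iff_le_toReal htop).1 h2
  · refine (ENNReal.toReal_le_of_le_ofReal (by linarith [(abs_le.1 hb₀).2]) hJ₀).trans ?_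
    linarith [(abs_le.1 hb₀).1]

theorem secondMoment_gaussianLaw_ne_top : secondMoment (gaussianLaw d) ≠ ⊤ :=
  lintegral_ne_top_of_memLp_two
    (IsGaussian.memLp_two_id (μ := stdGaussian (EuclideanSpace ℝ (Fin d))))

theorem lintegral_secondMoment {μ ν : ProbabilityMeasure 𝔼} {π : ProbabilityMeasure (𝔼 × 𝔼)}
    (hπ : π ∈ couplings μ ν) :
    ∫⁻ x, secondMoment (condLaw π x) ∂(μ : Measure 𝔼) = secondMoment ν := by
  rw [secondMoment, ← hπ.2, ← hπ.1, Measure.snd, lintegral_map (by fun_prop) measurable_snd]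
  conv_rhs => rw [← (π : Measure (𝔼 × 𝔼)).disintegrate (π : Measure (𝔼 × 𝔼)).condKernel]
  rw [Measure.lintegral_compProd (by fun_prop)]
  rfl

/-- The pointwise identity integrates because the second moments of π_x integrate to that of ν.
Their total is thus the same for all martingale couplings, and the two objectives differ by a
decreasing affine map. -/
theorem martCost_weakCost_eq {μ ν : ProbabilityMeasure 𝔼} (hν : secondMoment ν ≠ ⊤)
    {π : ProbabilityMeasure (𝔼 × 𝔼)} (hπ : π ∈ martingaleCouplings μ ν) :
    ∃ r : ℝ, martCost μ π = r ∧ weakCost (martingaleCost (gaussianLaw d)) μ π =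
      ((2 * (secondMoment ν).toReal + (secondMoment (gaussianLaw d)).toReal - 2 * r : ℝ) :
        EReal) := by
  set γ := gaussianLaw d
  have hγ : secondMoment γ ≠ ⊤ := secondMoment_gaussianLaw_ne_top
  have hlaw : Measurable fun x => condLaw π x := measurable_kernelLaw _
  have hmeasM : Measurable fun x => secondMoment (condLaw π x) :=
    (Measure.measurable_lintegral (by fun_prop)).comp (measurable_subtype_coe.comp hlaw)
  have hmeasJ : Measurable fun x => momentCost γ (condLaw π x) :=
    (lowerSemicontinuous_momentCost γ).measurable.comp hlaw
  have hM := lintegral_secondMoment hπ.1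
  have hfin : ∀ᵐ x ∂(μ : Measure 𝔼), secondMoment (condLaw π x) ≠ ⊤ :=
    (ae_lt_top hmeasM (hM ▸ hν)).mono fun x hx => hx.ne
  have iM : Integrable (fun x => (secondMoment (condLaw π x)).toReal) (μ : Measure 𝔼) :=
    integrable_toReal_of_lintegral_ne_top hmeasM.aemeasurable (hM ▸ hν)
  have eM : ∫ x, (secondMoment (condLaw π x)).toReal ∂(μ : Measure 𝔼) =
      (secondMoment ν).toReal := by
    rw [integral_toReal hmeasM.aemeasurable (hfin.mono fun x hx => hx.lt_top), hM]
  have iJ : Integrable (fun x => (momentCost γ (condLaw π x)).toReal) (μ : Measure 𝔼) := by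
    refine ((iM.const_mul 3).add (integrable_const (2 * (secondMoment γ).toReal))).mono'
      hmeasJ.ennreal_toReal.aestronglyMeasurable (hfin.mono fun x hx => ?_)
    obtain ⟨-, -, -, -, h⟩ := exists_maxCov_eq hx hγ
    rw [Real.norm_of_nonneg ENNReal.toReal_nonneg]
    exact h
  let ρ : 𝔼 → ℝ := fun x => (2 * (secondMoment (condLaw π x)).toReal + (secondMoment γ).toReal -
    (momentCost γ (condLaw π x)).toReal) / 2
  have i6 : Integrable (fun x => 2 * (secondMoment (condLaw π x)).toReal +
      (secondMoment γ).toReal) (μ : Measure 𝔼) := (iM.const_mul 2).add (integrable_const _)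
  have iρ : Integrable ρ (μ : Measure 𝔼) := (i6.sub iJ).div_const 2
  have eρ : ∫ x, ρ x ∂(μ : Measure 𝔼) = (2 * (secondMoment ν).toReal + (secondMoment γ).toReal -
      ∫ x, (momentCost γ (condLaw π x)).toReal ∂(μ : Measure 𝔼)) / 2 := by
    simp only [ρ]
    rw [integral_div, integral_sub i6 iJ, integral_add (iM.const_mul 2) (integrable_const _),
      integral_const_mul, eM]
    simp
  refine ⟨∫ x, ρ x ∂(μ : Measure 𝔼), ?_, ?_⟩
  · rw [← extIntegral_coe iρ, martCost]
    refine extIntegral_congr_ae (hfin.mono fun x hx => ?_)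
    obtain ⟨r, hr, -, h, -⟩ := exists_maxCov_eq hx hγ
    rw [hr, EReal.coe_eq_coe_iff]
    simp only [ρ]
    rw [h]
    ring
  · rw [eρ, weakCost]
    have : 2 * (secondMoment ν).toReal + (secondMoment γ).toReal - 2 * ((2 * (secondMoment ν).toReal
        + (secondMoment γ).toReal - ∫ x, (momentCost γ (condLaw π x)).toReal ∂(μ : Measure 𝔼)) / 2)
        = ∫ x, (momentCost γ (condLaw π x)).toReal ∂(μ : Measure 𝔼) := by ring
    rw [this, ← extIntegral_coe iJ]
    refine extIntegral_congr_ae ?_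
    filter_upwards [hfin, hπ.2] with x hx hx'
    obtain ⟨-, -, h, -⟩ := exists_maxCov_eq hx hγ
    rw [martingaleCost, if_pos hx', EReal.coe_ennreal_toReal h]

theorem martingaleCost_nonneg (n : ProbabilityMeasure 𝔼) (x : 𝔼) (m : ProbabilityMeasure 𝔼) :
    0 ≤ martingaleCost n x m := by
  unfold martingaleCost
  split_ifs
  · exact EReal.coe_ennreal_nonneg _
  · exact le_top

theorem mem_martingaleCouplings_of_weakCost_ne_top {n μ ν : ProbabilityMeasure 𝔼}
    {π : ProbabilityMeasure (𝔼 × 𝔼)} (hπ : π ∈ couplings μ ν)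
    (h : weakCost (martingaleCost n) μ π ≠ ⊤) : π ∈ martingaleCouplings μ ν := by
  have hmeas : Measurable fun x => martingaleCost n x (condLaw π x) :=
    (measurable_martingaleCost n).comp (measurable_id.prodMk (measurable_kernelLaw _))
  have h0 : (0 : EReal) ≤ weakCost (martingaleCost n) μ π := by
    have := extIntegral_coe (integrable_zero 𝔼 ℝ (μ : Measure 𝔼))
    simp only [Pi.zero_apply, integral_zero, EReal.coe_zero] at this
    rw [← this]
    exact extIntegral_mono_ae (Eventually.of_forall fun x => martingaleCost_nonneg n x _)
  obtain ⟨htop, -⟩ := extIntegral_eq_coe_of_finite hmeas.aemeasurable h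
    (EReal.bot_lt_zero.trans_le h0).ne'
  refine ⟨hπ, htop.mono fun x hx => ?_⟩
  by_contra hmean
  exact hx (if_neg hmean)

theorem IsMartOptimizer.isWeakOptimizer {μ ν : ProbabilityMeasure 𝔼} (hν : secondMoment ν ≠ ⊤)
    {π : ProbabilityMeasure (𝔼 × 𝔼)} (hπ : IsMartOptimizer μ ν π) :
    IsWeakOptimizer (martingaleCost (gaussianLaw d)) μ ν π ∧
      ∃ v : ℝ, weakValue (martingaleCost (gaussianLaw d)) μ ν = v := by
  obtain ⟨r, hr, hrC⟩ := martCost_weakCost_eq hν hπ.1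
  have hopt : IsWeakOptimizer (martingaleCost (gaussianLaw d)) μ ν π := by
    refine ⟨hπ.1.1, le_antisymm (le_iInf₂ fun π' hπ' => ?_) (iInf₂_le π hπ.1.1)⟩
    by_cases htop : weakCost (martingaleCost (gaussianLaw d)) μ π' = ⊤
    · rw [htop]
      exact le_top
    -- The weak problem ranges over all couplings, but a finite cost forces the mean constraint
    -- almost everywhere.
    have hmart := mem_martingaleCouplings_of_weakCost_ne_top hπ' htop
    obtain ⟨r', hr', hrC'⟩ := martCost_weakCost_eq hν hmart
    have hle : martCost μ π' ≤ martCost μ π := hπ.2 ▸ le_iSup₂ (f := fun π' _ => martCost μ π')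
      π' hmart
    rw [hr, hr', EReal.coe_le_coe_iff] at hle
    rw [hrC, hrC', EReal.coe_le_coe_iff]
    linarith
  exact ⟨hopt, _, hopt.2.symm.trans hrC⟩

theorem secondMoment_add_eq {m m' p p' : ProbabilityMeasure 𝔼}
    (h : (m : Measure 𝔼) + (m' : Measure 𝔼) = (p : Measure 𝔼) + (p' : Measure 𝔼)) :
    secondMoment m + secondMoment m' = secondMoment p + secondMoment p' := by
  unfold secondMoment
  rw [← lintegral_add_measure, h, lintegral_add_measure]

theorem isTwoPointOptimal_of_le {x x' : 𝔼} {p p' : ProbabilityMeasure 𝔼} (hp : HasMean p x)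
    (hp' : HasMean p' x') (hs : secondMoment p ≠ ⊤) (hs' : secondMoment p' ≠ ⊤)
    (h : ∀ m m' : ProbabilityMeasure 𝔼,
      (m : Measure 𝔼) + (m' : Measure 𝔼) = (p : Measure 𝔼) + (p' : Measure 𝔼) →
      martingaleCost (gaussianLaw d) x p + martingaleCost (gaussianLaw d) x' p' ≤
        martingaleCost (gaussianLaw d) x m + martingaleCost (gaussianLaw d) x' m') :
    IsTwoPointOptimal x x' p p' := by
  have hmem : (p, p') ∈ twoPointFeasible x x' p p' := ⟨hp, hp', rfl⟩
  refine ⟨hmem, le_antisymm (le_iInf₂ ?_) (iInf₂_le _ hmem)⟩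
  rintro ⟨m, m'⟩ ⟨hm, hm', hmm⟩
  have hle := h m m' hmm
  simp only [martingaleCost] at hle
  rw [if_pos hp, if_pos hp', if_pos hm, if_pos hm', ← EReal.coe_ennreal_add,
    ← EReal.coe_ennreal_add, EReal.coe_ennreal_le_coe_ennreal_iff] at hle
  simp only [momentCost_eq_add_wasserstein2] at hle
  -- The total second moment depends only on the common sum of the two laws and is finite, so it
  -- cancels and leaves the Wasserstein terms.
  rw [add_add_add_comm, add_add_add_comm (secondMoment m), secondMoment_add_eq hmm] at hle
  exact (ENNReal.add_le_add_iff_left (ENNReal.add_ne_top.2 ⟨hs, hs'⟩)).1 hle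

theorem IsMartOptimizer.exists_isTwoPointOptimal_set {μ ν : ProbabilityMeasure 𝔼}
    {π : ProbabilityMeasure (𝔼 × 𝔼)} (hν : secondMoment ν ≠ ⊤) (hπ : IsMartOptimizer μ ν π)
    (κ : Kernel 𝔼 𝔼) [IsMarkovKernel κ] (hκ : (π : Measure (𝔼 × 𝔼)).IsCondKernel κ) :
    ∃ Γ : Set 𝔼, MeasurableSet Γ ∧ (μ : Measure 𝔼) Γ = 1 ∧
      ∀ x ∈ Γ, ∀ x' ∈ Γ, IsTwoPointOptimal x x' (kernelLaw κ x) (kernelLaw κ x') := by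
  obtain ⟨hopt, v, hv⟩ := hπ.isWeakOptimizer hν
  obtain ⟨Γ, hΓ, hΓ1, hswap⟩ := hopt.exists_swap_monotone_set
    (fun x m => martingaleCost_ne_bot _ x m) (measurable_martingaleCost _)
    (Eventually.of_forall fun x => ⟨convexOnLaws_martingaleCost _ x,
      lowerSemicontinuous_martingaleCost _ x⟩)
    (hv ▸ EReal.coe_ne_top v) (hv ▸ EReal.coe_ne_bot v) κ hκ
  have hlaw := measurable_kernelLaw κ
  have hmeasM : Measurable fun x => secondMoment (kernelLaw κ x) :=
    (Measure.measurable_lintegral (by fun_prop)).comp (measurable_subtype_coe.comp hlaw)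
  have hms : MeasurableSet {x | HasMean (kernelLaw κ x) x ∧ secondMoment (kernelLaw κ x) < ⊤} :=
    (measurableSet_hasMean.preimage (measurable_id.prodMk hlaw)).inter
      (measurableSet_lt hmeasM measurable_const)
  have hcond := (weakCost_eq_of_isCondKernel (C := martingaleCost (gaussianLaw d))
    hπ.1.1.1 κ).1
  have hae : ∀ᵐ x ∂(μ : Measure 𝔼),
      HasMean (kernelLaw κ x) x ∧ secondMoment (kernelLaw κ x) < ⊤ := by
    have hM : ∫⁻ x, secondMoment (kernelLaw κ x) ∂(μ : Measure 𝔼) ≠ ⊤ := by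
      rw [lintegral_congr_ae (hcond.mono fun x hx => congrArg secondMoment hx.symm),
        lintegral_secondMoment hπ.1.1]
      exact hν
    filter_upwards [hπ.1.2, hcond, ae_lt_top hmeasM hM] with x h1 h2 h3
    exact ⟨h2 ▸ h1, h3⟩
  refine ⟨Γ ∩ {x | HasMean (kernelLaw κ x) x ∧ secondMoment (kernelLaw κ x) < ⊤},
    hΓ.inter hms, ?_, ?_⟩
  · rw [← prob_compl_eq_zero_iff (hΓ.inter hms), compl_inter]
    exact measure_union_null ((prob_compl_eq_zero_iff hΓ).2 hΓ1) hae
  · rintro x ⟨hx, hxm, hxs⟩ x' ⟨hx', hxm', hxs'⟩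
    exact isTwoPointOptimal_of_le hxm hxm' hxs.ne hxs'.ne (hswap x hx x' hx')

end Bass

end

end WeakTransport

theorem mainTheorem9 :
    (∀ (X : Type*) (Y : Type*)
      [TopologicalSpace X] [PolishSpace X] [MeasurableSpace X] [BorelSpace X]
      [TopologicalSpace Y] [PolishSpace Y] [MeasurableSpace Y] [BorelSpace Y] [Nonempty Y]
      (C : X → ProbabilityMeasure Y → EReal)
      (μ : ProbabilityMeasure X) (ν : ProbabilityMeasure Y) (π : ProbabilityMeasure (X × Y)),
      (∀ x m, C x m ≠ ⊥) →
      Measurable (fun z : X × ProbabilityMeasure Y => C z.1 z.2) →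
      (∀ᵐ x ∂(μ : Measure X), WeakTransport.ConvexOnLaws (C x) ∧ LowerSemicontinuous (C x)) →
      WeakTransport.weakValue C μ ν ≠ ⊤ →
      WeakTransport.weakValue C μ ν ≠ ⊥ →
      WeakTransport.IsWeakOptimizer C μ ν π →
      ∀ (κ : Kernel X Y) [IsMarkovKernel κ], (π : Measure (X × Y)).IsCondKernel κ →
        ∃ Γ : Set X, MeasurableSet Γ ∧ (μ : Measure X) Γ = 1 ∧
          ∀ x ∈ Γ, ∀ x' ∈ Γ, ∀ m m' : ProbabilityMeasure Y,
            (m : Measure Y) + (m' : Measure Y) = κ x + κ x' →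
            C x (WeakTransport.kernelLaw κ x) + C x' (WeakTransport.kernelLaw κ x') ≤
              C x m + C x' m') ∧
    (∀ (d : ℕ) (μ ν : ProbabilityMeasure (EuclideanSpace ℝ (Fin d)))
      (π : ProbabilityMeasure (EuclideanSpace ℝ (Fin d) × EuclideanSpace ℝ (Fin d))),
      MemLp id 2 (μ : Measure (EuclideanSpace ℝ (Fin d))) →
      MemLp id 2 (ν : Measure (EuclideanSpace ℝ (Fin d))) →
      WeakTransport.IsMartOptimizer μ ν π →
      ∀ (κ : Kernel (EuclideanSpace ℝ (Fin d)) (EuclideanSpace ℝ (Fin d))) [IsMarkovKernel κ],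
        (π : Measure (EuclideanSpace ℝ (Fin d) × EuclideanSpace ℝ (Fin d))).IsCondKernel κ →
        ∃ Γ : Set (EuclideanSpace ℝ (Fin d)), MeasurableSet Γ ∧
          (μ : Measure (EuclideanSpace ℝ (Fin d))) Γ = 1 ∧
          ∀ x ∈ Γ, ∀ x' ∈ Γ,
            WeakTransport.IsTwoPointOptimal x x'
              (WeakTransport.kernelLaw κ x) (WeakTransport.kernelLaw κ x')) := by
  refine ⟨?_, ?_⟩
  · intro X Y _ _ _ _ _ _ _ _ _ C μ ν π hbot hC hconv hvt hvb hπ κ _ hκ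
    exact hπ.exists_swap_monotone_set hbot hC hconv hvt hvb κ hκ
  · intro d μ ν π _ hν hπ κ _ hκ
    exact hπ.exists_isTwoPointOptimal_set (WeakTransport.lintegral_ne_top_of_memLp_two hν) κ hκ
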